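/- Let $m\ge 0$ be an integer, $\gamma_0,\dots,\gamma_m\in(0,1]$, $\alpha_k=\gamma_0+\dots+\gamma_k-1$ for $0\le k\le m$, and assume $\alpha:=\alpha_m>0$ (so $m\ge1$). Let $s\ge 0$ and $\lambda\in\mathbb C$. For real $\gamma$ and $g:(0,\infty)\to\mathbb C$ let $$D^{\gamma}g(y)=\frac1{\Gamma(-\gamma)}\int_0^y\frac{g(t)\,dt}{(y-t)^{1+\gamma}}\ (\gamma<0),\qquad D^0g=g,\qquad D^\gamma g=\Big(\frac{d}{dy}\Big)^pD^{\gamma-p}g\ (p-1<\gamma\le p,\ p\in\mathbb N),$$ and let $D^{\{\gamma_0,\dots,\gamma_m\}}=D^{\gamma_m-1}D^{\gamma_{m-1}}\cdots D^{\gamma_0}$ be the Dzhrbashyan–Nersesyan operator of order $\alpha$. A solution of $$D^{\{\gamma_0,\dots,\gamma_m\}}u(y)=\lambda y^s u(y),\qquad y>0,\tag{1}$$ is a function $u:(0,\infty)\to\mathbb C$ for which all the integrals (absolutely convergent) and derivatives in the composition exist at every $y>0$, and for which (1) holds at every $y>0$. For $0\le k\le m-1$ put $$u_k(y)=y^{\alpha_k}E_{\alpha,\frac{\alpha+s}{\alpha},\frac{\alpha_k+s}{\alpha}}(\lambda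 y^{\alpha+s}),\quad y>0,$$ where $$E_{\alpha,\mu,l}(z)=\sum_{i=0}^\infty c_iz^i,\qquad c_i=\prod_{j=0}^{i-1}\frac{\Gamma(\alpha(j\mu+l)+1)}{\Gamma(\alpha(j\mu+l+1)+1)}\quad(c_0=1)$$ is the Kilbas–Saigo function. Then: 1. For each $k=0,\dots,m-1$ the power series of $E_{\alpha,(\alpha+s)/\alpha,(\alpha_k+s)/\alpha}(z)$ converges absolutely for every $z\in\mathbb C$, and for all $y>0$ $$u_k(y)=y^{\alpha_k}\sum_{n=0}^\infty\frac{\prod_{j=0}^{n-1}\Gamma((\alpha+s)j+s+\alpha_k+1)}{\prod_{j=0}^{n-1}\Gamma((\alpha+s)j+s+\alpha_k+1+\alpha)}(\lambda y^{\alpha+s})^n .$$ 2. The functions $u_0,\dots,u_{m-1}$ are continuous on $(0,\infty)$ and linearly independent over $\mathbb C$. 3. For every $k\in\{0,\dots,m-1\}$ such that $\lambda=0$ or $\alpha_k+s+\gamma_m>0$, the function $u_k$ is a solution of (1). In particular, all of $u_0,\dots,u_{m-1}$ are solutions if $\lambda=0$ or $\gamma_0+\gamma_m+s>1$. 4. Every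 solution of (1) coincides almost everywhere on $(0,\infty)$ with a linear combination $\sum_{k=0}^{m-1}d_ku_k$, $d_k\in\mathbb C$. If $\lambda=0$ or $\gamma_0+\gamma_m+s>1$, then a continuous function $u:(0,\infty)\to\mathbb C$ is a solution of (1) if and only if $u=\sum_{k=0}^{m-1}d_ku_k$ on $(0,\infty)$ for some constants $d_k\in\mathbb C$; that is, this formula is the general solution of (1). -/

import Mathlib

open MeasureTheory Set

noncomputable section

namespace DN

/-- Riemann–Liouville fractional integral of order `β ≥ 0` with base point `0`
(the identity for `β = 0`); only used at points `y > 0`. -/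
def rlIntegral (β : ℝ) (g : ℝ → ℂ) (y : ℝ) : ℂ :=
  if β = 0 then g y
  else ((Real.Gamma β)⁻¹ : ℝ) • ∫ t in (0 : ℝ)..y, ((y - t) ^ (β - 1) : ℝ) • g t

/-- The integral defining `rlIntegral β g y` converges absolutely
(no condition for `β = 0`). -/
def RLIntegralExists (β : ℝ) (g : ℝ → ℂ) (y : ℝ) : Prop :=
  β = 0 ∨ IntervalIntegrable (fun t => ((y - t) ^ (β - 1) : ℝ) • g t) volume 0 y

/-- Riemann–Liouville integro-differentiation `D_{0y}^γ` of arbitrary real order: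
with `p = ⌈γ⌉₊` it is the `p`-th derivative of the fractional integral of order `p - γ`.
Thus `p = 0` for `γ ≤ 0`, and `p - 1 < γ ≤ p` for `γ > 0`. -/
def rlOp (γ : ℝ) (g : ℝ → ℂ) : ℝ → ℂ :=
  iteratedDeriv ⌈γ⌉₊ (rlIntegral (⌈γ⌉₊ - γ) g)

/-- `D_{0y}^γ g` exists at every point of `(0, ∞)`: the integral converges there and the
required number of derivatives exist. -/
def RLOpExists (γ : ℝ) (g : ℝ → ℂ) : Prop :=
  (∀ y, 0 < y → RLIntegralExists (⌈γ⌉₊ - γ) g y) ∧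
  ∀ i < ⌈γ⌉₊, ∀ y, 0 < y →
    DifferentiableAt ℝ (iteratedDeriv i (rlIntegral (⌈γ⌉₊ - γ) g)) y

/-- The composition `D^{γ_{k-1}} ⋯ D^{γ_1} D^{γ_0} u`. -/
def rlComp (γ : ℕ → ℝ) (u : ℝ → ℂ) : ℕ → ℝ → ℂ
  | 0 => u
  | k + 1 => rlOp (γ k) (rlComp γ u k)

/-- Dzhrbashyan–Nersesyan operator
`D^{γ_0,…,γ_m} u = D^{γ_m - 1} D^{γ_{m-1}} ⋯ D^{γ_0} u`. Only `γ 0, …, γ m` matter. -/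
def dnDeriv (γ : ℕ → ℝ) (m : ℕ) (u : ℝ → ℂ) : ℝ → ℂ :=
  rlOp (γ m - 1) (rlComp γ u m)

/-- All the operations in `D^{γ_0,…,γ_m} u` can be performed on `(0, ∞)`. -/
def DNDerivExists (γ : ℕ → ℝ) (m : ℕ) (u : ℝ → ℂ) : Prop :=
  (∀ k < m, RLOpExists (γ k) (rlComp γ u k)) ∧ RLOpExists (γ m - 1) (rlComp γ u m)

/-- `α_k = γ_0 + ⋯ + γ_k - 1`; the order of the operator is `α = α_m`. -/
def dnExp (γ : ℕ → ℝ) (k : ℕ) : ℝ := ∑ j ∈ Finset.range (k + 1), γ j - 1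

/-- `u` solves `D^{γ_0,…,γ_m} u(y) = lam y^s u(y)` for all `y > 0`. -/
def IsSolution (γ : ℕ → ℝ) (m : ℕ) (s : ℝ) (lam : ℂ) (u : ℝ → ℂ) : Prop :=
  DNDerivExists γ m u ∧ ∀ y, 0 < y → dnDeriv γ m u y = lam * ((y ^ s : ℝ) : ℂ) * u y

/-- Coefficients of the Kilbas–Saigo function `E_{α,μ,l}`. -/
def kilbasSaigoCoeff (α μ l : ℝ) (i : ℕ) : ℝ :=
  ∏ j ∈ Finset.range i,
    Real.Gamma (α * (j * μ + l) + 1) / Real.Gamma (α * (j * μ + l + 1) + 1)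

/-- Kilbas–Saigo function `E_{α,μ,l}(z)`. -/
def kilbasSaigo (α μ l : ℝ) (z : ℂ) : ℂ :=
  ∑' i : ℕ, (kilbasSaigoCoeff α μ l i : ℂ) * z ^ i

/-- `u_k(y) = y^{α_k} E_{α,(α+s)/α,(α_k+s)/α}(lam y^{α+s})`, where `α = α_m`. -/
def fundSol (γ : ℕ → ℝ) (m : ℕ) (s : ℝ) (lam : ℂ) (k : ℕ) (y : ℝ) : ℂ :=
  ((y ^ dnExp γ k : ℝ) : ℂ) *
    kilbasSaigo (dnExp γ m) ((dnExp γ m + s) / dnExp γ m) ((dnExp γ k + s) / dnExp γ m)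
      (lam * ((y ^ (dnExp γ m + s) : ℝ) : ℂ))

end DN

end

/-!
The series `u_k` are generalized power series `∑ aₙ y^{b + n c}` with `c = α + s` and entire
coefficient sequence `a` (`IsEntireSeq`, obtained from `Γ(x) / Γ(x + β) → 0`). Such series can be
integrated to fractional order and differentiated term by term (`rlIntegral_genSeries`,
`hasRLDeriv_genSeries`), so that the composition of operators acts on each power separately:
`D^{γ_k} ⋯ D^{γ_0}` kills the leading term `y^{α_k}`, and the Gamma factors of the other terms
telescope to those in the recursion for the coefficients (`isSolution_fundSol`). The condition
`α_k + s + γ_m > 0` says that all exponents met after the leading term are integrable at `0`.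
Linear independence follows from `u_k ∼ y^{α_k}` at `0`.

Conversely, let `w_0 = u, w_1, …, w_m` be the intermediate functions of a solution. They are
integrable near `0`: if some `γ_j < 1`, the existence of the fractional integral of `w_j` gives this
for `w_j`, and the relations between consecutive functions propagate it; if all `γ_j = 1`, the
equation is a linear ordinary differential equation and Grönwall's inequality applies
(`IsSolutionChain.locInt`). Each derivative can then be inverted,
`w_j = b_j y^{γ_j - 1} + I^{γ_j} w_{j+1}` almost everywhere (`HasRLDeriv.exists_ae_eq`), and the
semigroup property of fractional integrals (associativity of convolution) yields the Volterra
equation `u = ∑ d_k y^{α_k} + I^α (λ y^s u)` (`IsSolutionChain.exists_volterra`). The combination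
`∑ d_k u_k` satisfies the same equation (`fundSol_volterra`), and the solution is unique because the
Volterra operator is a contraction in a space `L¹(e^{-σy} dy)`
(`LocInt.ae_eq_zero_of_volterra`).
-/

namespace DN

open Filter Topology

/-! ### Ratios of Gamma values and the Kilbas–Saigo series -/

/-- For `0 < β ≤ 1` log-convexity of `Γ` on `[x + β, x + β + 1]`, evaluated at `x + 1`, gives
`x Γ(x) ≤ (x + β)^{1 - β} Γ(x + β)`. -/
lemma Gamma_div_Gamma_add_le {x β : ℝ} (hx : 0 < x) (hβ : 0 < β) (hβ1 : β ≤ 1) :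
    Real.Gamma x / Real.Gamma (x + β) ≤ (x + β) ^ (1 - β) / x := by
  have hG := Real.Gamma_pos_of_pos (add_pos hx hβ)
  rw [div_le_div_iff₀ hG hx]
  rcases hβ1.eq_or_lt with rfl | hlt
  · simp [Real.Gamma_add_one hx.ne', mul_comm]
  have h := Real.Gamma_mul_add_mul_le_rpow_Gamma_mul_rpow_Gamma (add_pos hx hβ)
    (add_pos (add_pos hx hβ) one_pos) hβ (sub_pos.2 hlt) (by ring)
  rw [Real.Gamma_add_one (add_pos hx hβ).ne',
    Real.mul_rpow (add_pos hx hβ).le hG.le, mul_left_comm, ← Real.rpow_add hG] at h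
  rw [show β * (x + β) + (1 - β) * (x + β + 1) = x + 1 by ring, Real.Gamma_add_one hx.ne',
    add_sub_cancel, Real.rpow_one] at h
  linarith

lemma tendsto_Gamma_div_Gamma_add {β : ℝ} (hβ : 0 < β) :
    Tendsto (fun x => Real.Gamma x / Real.Gamma (x + β)) atTop (𝓝 0) := by
  -- It is enough to treat a smaller shift `δ ≤ 1`, as `Γ` is increasing on `[2, ∞)`.
  set δ := min β 1 with hδ
  have hδ0 : 0 < δ := lt_min hβ one_pos
  have hδ1 : δ ≤ 1 := min_le_right _ _
  have hb : Tendsto (fun x : ℝ => (2 : ℝ) ^ (1 - δ) * x ^ (-δ)) atTop (𝓝 0) := by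
    simpa using (tendsto_rpow_neg_atTop hδ0).const_mul ((2 : ℝ) ^ (1 - δ))
  refine squeeze_zero' ?_ ?_ hb
  · filter_upwards [eventually_gt_atTop 0] with x hx
    exact (div_pos (Real.Gamma_pos_of_pos hx) (Real.Gamma_pos_of_pos (by linarith))).le
  · filter_upwards [eventually_ge_atTop 2] with x hx
    have hx0 : 0 < x := by linarith
    have h1 : Real.Gamma (x + δ) ≤ Real.Gamma (x + β) :=
      Real.Gamma_strictMonoOn_Ici.monotoneOn (mem_Ici.2 (by linarith)) (mem_Ici.2 (by linarith))
        (by linarith [min_le_left β 1])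
    calc Real.Gamma x / Real.Gamma (x + β) ≤ Real.Gamma x / Real.Gamma (x + δ) :=
          div_le_div_of_nonneg_left (Real.Gamma_pos_of_pos hx0).le
            (Real.Gamma_pos_of_pos (by linarith)) h1
      _ ≤ (x + δ) ^ (1 - δ) / x := Gamma_div_Gamma_add_le hx0 hδ0 hδ1
      _ ≤ (2 * x) ^ (1 - δ) / x := by
          gcongr
          · linarith
      _ = (2 : ℝ) ^ (1 - δ) * x ^ (-δ) := by
          rw [Real.mul_rpow (by norm_num) hx0.le, mul_div_assoc, show -δ = (1 - δ) - 1 by ring,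
            Real.rpow_sub_one hx0.ne']

/-- A coefficient sequence whose power series converges absolutely on the whole plane. -/
def IsEntireSeq (a : ℕ → ℂ) : Prop := ∀ R : ℝ, 0 < R → Summable fun n => ‖a n‖ * R ^ n

lemma IsEntireSeq.of_bound {a b : ℕ → ℂ} (ha : IsEntireSeq a) {C : ℝ}
    (h : ∀ᶠ n in atTop, ‖b n‖ ≤ C * ‖a n‖) : IsEntireSeq b := by
  intro R hR
  refine Summable.of_norm_bounded_eventually_nat ((ha R hR).mul_left C) ?_
  filter_upwards [h] with n hn
  rw [Real.norm_of_nonneg (by positivity), ← mul_assoc]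
  gcongr

lemma IsEntireSeq.mul_affine {a : ℕ → ℂ} (ha : IsEntireSeq a) (b c : ℝ) :
    IsEntireSeq fun n => a n * ((b + n * c : ℝ) : ℂ) := by
  intro R hR
  refine Summable.of_nonneg_of_le (fun n => by positivity) (fun n => ?_)
    ((ha (2 * R) (by positivity)).mul_left (|b| + |c|))
  have h2 : (n : ℝ) ≤ 2 ^ n := by exact_mod_cast Nat.lt_two_pow_self.le
  have h1 : (1 : ℝ) ≤ 2 ^ n := one_le_pow₀ (by norm_num)
  have h3 : |b + n * c| ≤ (|b| + |c|) * 2 ^ n := by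
    calc |b + n * c| ≤ |b| + |n * c| := abs_add_le _ _
      _ = |b| * 1 + |c| * n := by rw [abs_mul, Nat.abs_cast]; ring
      _ ≤ |b| * 2 ^ n + |c| * 2 ^ n := by gcongr
      _ = _ := by ring
  rw [norm_mul, Complex.norm_real, Real.norm_eq_abs, mul_pow]
  calc ‖a n‖ * |b + n * c| * R ^ n ≤ ‖a n‖ * ((|b| + |c|) * 2 ^ n) * R ^ n := by gcongr
    _ = _ := by ring

lemma IsEntireSeq.mul_Gamma_ratio {a : ℕ → ℂ} (ha : IsEntireSeq a) {x : ℕ → ℝ}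
    (hx : Tendsto x atTop atTop) {β : ℝ} (hβ : 0 ≤ β) :
    IsEntireSeq fun n => a n * ((Real.Gamma (x n) / Real.Gamma (x n + β) : ℝ) : ℂ) := by
  refine ha.of_bound (C := 1) ?_
  have : ∀ᶠ n in atTop, ‖Real.Gamma (x n) / Real.Gamma (x n + β)‖ ≤ 1 := by
    rcases hβ.eq_or_lt with rfl | hβ
    · exact Eventually.of_forall fun n => by
        rw [add_zero]; rcases eq_or_ne (Real.Gamma (x n)) 0 with h | h <;> simp [h]
    · have := ((tendsto_Gamma_div_Gamma_add hβ).comp hx).norm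
      rw [norm_zero] at this
      exact this.eventually_le_const one_pos
  filter_upwards [this] with n hn
  rw [norm_mul, Complex.norm_real, mul_comm]
  gcongr

lemma IsEntireSeq.mul_pow {a : ℕ → ℂ} (ha : IsEntireSeq a) (z : ℂ) :
    IsEntireSeq fun n => a n * z ^ n := by
  intro R hR
  refine Summable.of_nonneg_of_le (fun n => by positivity) (fun n => ?_)
    (ha ((‖z‖ + 1) * R) (by positivity))
  rw [norm_mul, norm_pow, _root_.mul_pow, mul_assoc]
  gcongr
  linarith

/-- A product of Gamma ratios along a sequence tending to `∞` decays superexponentially: the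
ratio test applies with limit `0`. -/
lemma isEntireSeq_prod_Gamma_ratio {x : ℕ → ℝ} (hx0 : ∀ n, 0 < x n) (hx : Tendsto x atTop atTop)
    {β : ℝ} (hβ : 0 < β) :
    IsEntireSeq fun n => ((∏ j ∈ Finset.range n,
      Real.Gamma (x j) / Real.Gamma (x j + β) : ℝ) : ℂ) := by
  intro R hR
  have hpos : ∀ j, 0 < Real.Gamma (x j) / Real.Gamma (x j + β) := fun j =>
    div_pos (Real.Gamma_pos_of_pos (hx0 j)) (Real.Gamma_pos_of_pos (add_pos (hx0 j) hβ))
  have hP : ∀ n, 0 < ∏ j ∈ Finset.range n, Real.Gamma (x j) / Real.Gamma (x j + β) :=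
    fun n => Finset.prod_pos fun j _ => hpos j
  have key : ∀ n, ‖((∏ j ∈ Finset.range n, Real.Gamma (x j) / Real.Gamma (x j + β) : ℝ) : ℂ)‖ =
      ∏ j ∈ Finset.range n, Real.Gamma (x j) / Real.Gamma (x j + β) := fun n => by
    rw [Complex.norm_real, Real.norm_of_nonneg (hP n).le]
  simp_rw [key]
  refine summable_of_ratio_test_tendsto_lt_one (l := 0) one_pos
    (Eventually.of_forall fun n => (mul_pos (hP n) (pow_pos hR n)).ne') ?_
  have h := ((tendsto_Gamma_div_Gamma_add hβ).comp hx).mul_const R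
  rw [zero_mul] at h
  refine h.congr fun n => ?_
  rw [Real.norm_of_nonneg (mul_pos (hP _) (pow_pos hR _)).le,
    Real.norm_of_nonneg (mul_pos (hP _) (pow_pos hR _)).le, Finset.prod_range_succ, pow_succ]
  have := (hP n).ne'
  simp only [Function.comp]
  field_simp

/-! ### Fractional integrals of power functions -/

lemma rpow_mul_rpow_sub_integrable {x β : ℝ} (hx : 0 < x) (hβ : 0 < β) {y : ℝ} (hy : 0 < y) :
    IntervalIntegrable (fun t => (y - t) ^ (β - 1) * t ^ (x - 1)) volume 0 y := by
  have h1 : IntervalIntegrable (fun t => (y - t) ^ (β - 1) * t ^ (x - 1)) volume 0 (y / 2) := by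
    refine (intervalIntegral.intervalIntegrable_rpow' (by linarith)).continuousOn_mul ?_
    intro t ht
    rw [uIcc_of_le (by linarith)] at ht
    exact (ContinuousAt.rpow_const (by fun_prop)
      (Or.inl (by linarith [ht.2]))).continuousWithinAt
  have h2 : IntervalIntegrable (fun t => (y - t) ^ (β - 1) * t ^ (x - 1)) volume (y / 2) y := by
    refine IntervalIntegrable.mul_continuousOn ?_ ?_
    · have := (intervalIntegral.intervalIntegrable_rpow' (a := y / 2) (b := 0)
        (r := β - 1) (by linarith)).comp_sub_left y
      simpa [show y - y / 2 = y / 2 by ring] using this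
    · intro t ht
      rw [uIcc_of_le (by linarith)] at ht
      exact (ContinuousAt.rpow_const (by fun_prop)
        (Or.inl (by linarith [ht.1]))).continuousWithinAt
  exact h1.trans h2

lemma integral_rpow_mul_rpow_sub {x β : ℝ} (hx : 0 < x) (hβ : 0 < β) {y : ℝ} (hy : 0 < y) :
    ∫ t in (0 : ℝ)..y, (y - t) ^ (β - 1) * t ^ (x - 1) =
      Real.Gamma β * Real.Gamma x / Real.Gamma (x + β) * y ^ (x + β - 1) := by
  have h := Complex.betaIntegral_scaled (x : ℂ) (β : ℂ) hy
  rw [Complex.betaIntegral_eq_Gamma_mul_div _ _ (by simpa) (by simpa)] at h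
  have h2 : ∫ t in (0 : ℝ)..y, (t : ℂ) ^ ((x : ℂ) - 1) * ((y : ℂ) - t) ^ ((β : ℂ) - 1) =
      ∫ t in (0 : ℝ)..y, (((y - t) ^ (β - 1) * t ^ (x - 1) : ℝ) : ℂ) := by
    refine intervalIntegral.integral_congr fun t ht => ?_
    rw [uIcc_of_le hy.le] at ht
    rw [Complex.ofReal_mul, Complex.ofReal_cpow (sub_nonneg.2 ht.2), Complex.ofReal_cpow ht.1]
    push_cast
    ring
  rw [h2, intervalIntegral.integral_ofReal] at h
  apply Complex.ofReal_injective
  rw [h]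
  push_cast
  rw [Complex.ofReal_cpow hy.le, ← Complex.Gamma_ofReal, ← Complex.Gamma_ofReal,
    ← Complex.Gamma_ofReal]
  push_cast
  ring

/-! ### Generalized power series -/

/-- The generalized power series `∑ aₙ y^{b + n c}`. -/
noncomputable def genSeries (a : ℕ → ℂ) (b c : ℝ) (y : ℝ) : ℂ :=
  ∑' n, a n * ((y ^ (b + n * c) : ℝ) : ℂ)

lemma rpow_add_nat_mul {y : ℝ} (hy : 0 < y) (b c : ℝ) (n : ℕ) :
    y ^ (b + n * c) = y ^ b * (y ^ c) ^ n := by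
  rw [Real.rpow_add hy, mul_comm (n : ℝ), Real.rpow_mul_natCast hy.le]

lemma summable_norm_genSeries {a : ℕ → ℂ} (ha : IsEntireSeq a) (b c : ℝ) {y : ℝ} (hy : 0 < y) :
    Summable fun n => ‖a n * ((y ^ (b + n * c) : ℝ) : ℂ)‖ := by
  refine ((ha (y ^ c) (by positivity)).mul_left (y ^ b)).congr fun n => ?_
  rw [norm_mul, Complex.norm_real, rpow_add_nat_mul hy, Real.norm_of_nonneg (by positivity)]
  ring

lemma hasSum_genSeries {a : ℕ → ℂ} (ha : IsEntireSeq a) (b c : ℝ) {y : ℝ} (hy : 0 < y) :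
    HasSum (fun n => a n * ((y ^ (b + n * c) : ℝ) : ℂ)) (genSeries a b c y) :=
  (summable_norm_genSeries ha b c hy).of_norm.hasSum

lemma hasDerivAt_genSeries {a : ℕ → ℂ} (ha : IsEntireSeq a) (b : ℝ) {c : ℝ} (hc : 0 < c) {y : ℝ}
    (hy : 0 < y) :
    HasDerivAt (genSeries a b c)
      (genSeries (fun n => a n * ((b + n * c : ℝ) : ℂ)) (b - 1) c y) y := by
  -- a constant dominating `t^{b-1}` on `(y/2, 2y)`, whatever the sign of the exponent
  set M := (y / 2) ^ (b - 1) + (2 * y) ^ (b - 1) with hM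
  have hbound : ∀ t ∈ Ioo (y / 2) (2 * y), t ^ (b - 1) ≤ M := fun t ht => by
    have h0 : 0 < y / 2 := by linarith
    have h1 : 0 ≤ (y / 2) ^ (b - 1) := by positivity
    have h2 : 0 ≤ (2 * y) ^ (b - 1) := by positivity
    rcases le_total 0 (b - 1) with h | h
    · have := Real.rpow_le_rpow (h0.le.trans ht.1.le) ht.2.le h
      linarith
    · have := Real.rpow_le_rpow_of_nonpos h0 ht.1.le h
      linarith
  have hu := ((ha.mul_affine b c) ((2 * y) ^ c) (by positivity)).mul_left M
  have hmem : y ∈ Ioo (y / 2) (2 * y) := ⟨by linarith, by linarith⟩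
  have := hasDerivAt_tsum_of_isPreconnected (g := fun n t => a n * ((t ^ (b + n * c) : ℝ) : ℂ))
    (g' := fun n t => a n * ((b + n * c : ℝ) : ℂ) * ((t ^ (b - 1 + n * c) : ℝ) : ℂ))
    hu (isOpen_Ioo (a := y / 2) (b := 2 * y)) isPreconnected_Ioo (fun n t ht => ?_)
    (fun n t ht => ?_) hmem (hasSum_genSeries ha b c hy).summable hmem
  · exact this
  · have ht0 : 0 < t := by linarith [ht.1]
    have h := ((Real.hasDerivAt_rpow_const (p := b + n * c) (Or.inl ht0.ne')).ofReal_comp).const_mul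
      (a n)
    convert! h using 1
    rw [show b - 1 + n * c = b + n * c - 1 by ring]
    push_cast
    ring
  · have ht0 : 0 < t := by linarith [ht.1]
    rw [norm_mul, Complex.norm_real, rpow_add_nat_mul ht0, Real.norm_of_nonneg (by positivity),
      mul_left_comm]
    have := ht.2.le
    gcongr
    exact hbound t ht

lemma continuousOn_genSeries {a : ℕ → ℂ} (ha : IsEntireSeq a) (b : ℝ) {c : ℝ} (hc : 0 < c) :
    ContinuousOn (genSeries a b c) (Ioi 0) := fun _ hy =>
  (hasDerivAt_genSeries ha b hc hy).continuousAt.continuousWithinAt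

lemma rpow_mul_genSeries (a : ℕ → ℂ) (b c s : ℝ) {y : ℝ} (hy : 0 < y) :
    ((y ^ s : ℝ) : ℂ) * genSeries a b c y = genSeries a (b + s) c y := by
  rw [genSeries, genSeries, ← tsum_mul_left]
  refine tsum_congr fun n => ?_
  rw [show b + s + n * c = s + (b + n * c) by ring,
    Real.rpow_add hy s (b + n * c)]
  push_cast
  ring

/-- Splitting off the leading term. -/
lemma genSeries_eq_add_shift {a : ℕ → ℂ} (ha : IsEntireSeq a) (b c : ℝ) {y : ℝ} (hy : 0 < y) :
    genSeries a b c y =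
      a 0 * ((y ^ b : ℝ) : ℂ) + genSeries (fun n => a (n + 1)) (b + c) c y := by
  rw [genSeries, (hasSum_genSeries ha b c hy).summable.tsum_eq_zero_add, genSeries]
  congr 1
  · simp
  · refine tsum_congr fun n => ?_
    rw [show b + c + n * c = b + (n + 1 : ℕ) * c by push_cast; ring]

lemma integrable_tsum_of_summable_integral_norm {α : Type*} [MeasurableSpace α] {μ : Measure α}
    {F : ℕ → α → ℂ} (hmeas : AEStronglyMeasurable (fun x => ∑' n, F n x) μ)
    (hF : ∀ n, Integrable (F n) μ) (hsum : Summable fun n => ∫ x, ‖F n x‖ ∂μ) :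
    Integrable (fun x => ∑' n, F n x) μ := by
  refine ⟨hmeas, ?_⟩
  calc ∫⁻ x, ‖∑' n, F n x‖ₑ ∂μ ≤ ∫⁻ x, ∑' n, ‖F n x‖ₑ ∂μ :=
        lintegral_mono fun x => enorm_tsum_le_tsum_enorm
    _ = ∑' n, ∫⁻ x, ‖F n x‖ₑ ∂μ := lintegral_tsum fun n => (hF n).1.enorm
    _ = ∑' n, ENNReal.ofReal (∫ x, ‖F n x‖ ∂μ) := by
        simp_rw [ofReal_integral_norm_eq_lintegral_enorm (hF _)]
    _ < ⊤ := by
        rw [← ENNReal.ofReal_tsum_of_nonneg (fun n => integral_nonneg fun x => norm_nonneg _) hsum]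
        exact ENNReal.ofReal_lt_top

/-- Term-by-term fractional integration. -/
lemma rlIntegral_genSeries {a : ℕ → ℂ} (ha : IsEntireSeq a) {b c : ℝ} (hc : 0 < c)
    (h : ∀ n, a n ≠ 0 → -1 < b + n * c) {β : ℝ} (hβ : 0 ≤ β) {y : ℝ} (hy : 0 < y) :
    RLIntegralExists β (genSeries a b c) y ∧ rlIntegral β (genSeries a b c) y =
      genSeries (fun n => a n * ((Real.Gamma (b + n * c + 1) /
        Real.Gamma (b + n * c + 1 + β) : ℝ) : ℂ)) (b + β) c y := by
  rcases hβ.eq_or_lt with rfl | hβ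
  · refine ⟨Or.inl rfl, ?_⟩
    rw [rlIntegral, if_pos rfl, genSeries, genSeries]
    refine tsum_congr fun n => ?_
    by_cases hn : a n = 0
    · simp [hn]
    · have := (Real.Gamma_pos_of_pos (show 0 < b + n * c + 1 by linarith [h n hn])).ne'
      simp [this]
  set r : ℕ → ℝ := fun n => Real.Gamma (b + n * c + 1) / Real.Gamma (b + n * c + 1 + β) with hr
  have hx : Tendsto (fun n : ℕ => b + n * c + 1) atTop atTop :=
    tendsto_atTop_add_const_right _ _ (tendsto_atTop_add_const_left _ _
      (tendsto_natCast_atTop_atTop.atTop_mul_const hc))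
  have har : IsEntireSeq fun n => a n * ((r n : ℝ) : ℂ) := ha.mul_Gamma_ratio hx hβ.le
  set F : ℕ → ℝ → ℂ := fun n t => ((y - t) ^ (β - 1) : ℝ) • (a n * ((t ^ (b + n * c) : ℝ) : ℂ))
    with hF
  have hFeq : ∀ n t, F n t = a n * (((y - t) ^ (β - 1) * t ^ (b + n * c + 1 - 1) : ℝ) : ℂ) := by
    intro n t
    rw [add_sub_cancel_right]
    simp only [hF, Complex.real_smul]
    push_cast
    ring
  have hFint : ∀ n, IntervalIntegrable (F n) volume 0 y := fun n => by
    rw [funext (hFeq n)]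
    by_cases hn : a n = 0
    · simp [hn]
    · have hi := rpow_mul_rpow_sub_integrable (x := b + n * c + 1) (by linarith [h n hn]) hβ hy
      exact IntervalIntegrable.const_mul ⟨hi.1.ofReal, hi.2.ofReal⟩ _
  have hFval : ∀ n, ∫ t in (0 : ℝ)..y, F n t =
      (Real.Gamma β : ℂ) * (a n * (r n : ℂ) * ((y ^ (b + β + n * c) : ℝ) : ℂ)) := fun n => by
    rw [funext (hFeq n)]
    by_cases hn : a n = 0
    · simp [hn]
    · rw [intervalIntegral.integral_const_mul, intervalIntegral.integral_ofReal,
        integral_rpow_mul_rpow_sub (by linarith [h n hn]) hβ hy,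
        show b + n * c + 1 + β - 1 = b + β + n * c by ring]
      simp only [hr]
      push_cast
      ring
  have hFnorm : ∀ n, ∫ t in Ioc 0 y, ‖F n t‖ =
      Real.Gamma β * ‖a n * (r n : ℂ) * ((y ^ (b + β + n * c) : ℝ) : ℂ)‖ := fun n => by
    by_cases hn : a n = 0
    · simp [hn, hFeq]
    · have hxn : 0 < b + n * c + 1 := by linarith [h n hn]
      have hrn : 0 < r n := div_pos (Real.Gamma_pos_of_pos hxn) (Real.Gamma_pos_of_pos (by linarith))
      have : ∫ t in Ioc 0 y, ‖F n t‖ =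
          ∫ t in Ioc 0 y, ‖a n‖ * ((y - t) ^ (β - 1) * t ^ (b + n * c + 1 - 1)) := by
        refine setIntegral_congr_fun measurableSet_Ioc fun t ht => ?_
        have h1 : 0 ≤ (y - t) ^ (β - 1) := Real.rpow_nonneg (sub_nonneg.2 ht.2) _
        have h2 : 0 ≤ t ^ (b + n * c + 1 - 1) := Real.rpow_nonneg ht.1.le _
        rw [hFeq, norm_mul, Complex.norm_real, Real.norm_of_nonneg (mul_nonneg h1 h2)]
      rw [this, ← intervalIntegral.integral_of_le hy.le, intervalIntegral.integral_const_mul,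
        integral_rpow_mul_rpow_sub hxn hβ hy, norm_mul, norm_mul, Complex.norm_real,
        Complex.norm_real, Real.norm_of_nonneg hrn.le, Real.norm_of_nonneg (by positivity),
        show b + n * c + 1 + β - 1 = b + β + n * c by ring]
      simp only [hr]
      ring
  have hFsum : Summable fun n => ∫ t in Ioc 0 y, ‖F n t‖ := by
    simp_rw [hFnorm]
    exact (summable_norm_genSeries har (b + β) c hy).mul_left _
  have hFint' : ∀ n, Integrable (F n) (volume.restrict (Ioc 0 y)) := fun n =>
    (intervalIntegrable_iff_integrableOn_Ioc_of_le hy.le).1 (hFint n)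
  have hFt : ∀ t, ∑' n, F n t = ((y - t) ^ (β - 1) : ℝ) • genSeries a b c t := fun t => by
    simp only [hF, genSeries, Complex.real_smul, tsum_mul_left]
  refine ⟨Or.inr ?_, ?_⟩
  · rw [intervalIntegrable_iff_integrableOn_Ioc_of_le hy.le]
    have := integrable_tsum_of_summable_integral_norm (F := F) ?_ hFint' hFsum
    · simp_rw [hFt] at this
      exact this
    · simp_rw [hFt]
      refine AEStronglyMeasurable.fun_smul ?_ ?_
      · exact ((measurable_const.sub measurable_id).pow_const _).aestronglyMeasurable
      · exact ((continuousOn_genSeries ha b hc).mono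
          (fun t ht => ht.1)).aestronglyMeasurable measurableSet_Ioc
  · have := hasSum_integral_of_summable_integral_norm hFint' hFsum
    simp_rw [hFt, ← intervalIntegral.integral_of_le hy.le, hFval] at this
    rw [rlIntegral, if_neg hβ.ne', ← this.tsum_eq, tsum_mul_left, Complex.real_smul, ← mul_assoc,
      genSeries]
    have hG : (Real.Gamma β : ℂ) ≠ 0 := by exact_mod_cast (Real.Gamma_pos_of_pos hβ).ne'
    rw [Complex.ofReal_inv, inv_mul_cancel₀ hG, one_mul]

/-! ### Riemann–Liouville derivatives of order in `(0, 1]` -/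

lemma rlIntegral_congr {β : ℝ} {g h : ℝ → ℂ} (hgh : EqOn g h (Ioi 0)) {y : ℝ} (hy : 0 < y) :
    rlIntegral β g y = rlIntegral β h y := by
  unfold rlIntegral
  split_ifs with hβ
  · exact hgh hy
  · congr 1
    rw [intervalIntegral.integral_of_le hy.le, intervalIntegral.integral_of_le hy.le]
    exact setIntegral_congr_fun measurableSet_Ioc fun t ht => by
      simp only [hgh (show t ∈ Ioi 0 from ht.1)]

lemma RLIntegralExists.congr {β : ℝ} {g h : ℝ → ℂ} (hgh : EqOn g h (Ioi 0)) {y : ℝ} (hy : 0 < y)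
    (hg : RLIntegralExists β g y) : RLIntegralExists β h y := by
  refine hg.imp_right fun hi => ?_
  rw [intervalIntegrable_iff_integrableOn_Ioc_of_le hy.le] at hi ⊢
  exact hi.congr_fun (fun t ht => by simp only [hgh (show t ∈ Ioi 0 from ht.1)]) measurableSet_Ioc

/-- `h` is the Riemann–Liouville derivative of order `γ ∈ (0, 1]` of `g` on `(0, ∞)`. Unlike
`rlOp`, this relation only sees the values of `g` and `h` on `(0, ∞)`. -/
def HasRLDeriv (γ : ℝ) (g h : ℝ → ℂ) : Prop :=
  (∀ y, 0 < y → RLIntegralExists (1 - γ) g y) ∧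
    ∀ y, 0 < y → HasDerivAt (rlIntegral (1 - γ) g) (h y) y

lemma HasRLDeriv.congr {γ : ℝ} {g h g' h' : ℝ → ℂ} (H : HasRLDeriv γ g h)
    (hg : EqOn g g' (Ioi 0)) (hh : EqOn h h' (Ioi 0)) : HasRLDeriv γ g' h' := by
  refine ⟨fun y hy => (H.1 y hy).congr hg hy, fun y hy => ?_⟩
  rw [← hh hy]
  refine (H.2 y hy).congr_of_eventuallyEq ?_
  filter_upwards [Ioi_mem_nhds hy] with z hz
  exact (rlIntegral_congr hg hz).symm

lemma natCeil_eq_one {γ : ℝ} (h0 : 0 < γ) (h1 : γ ≤ 1) : ⌈γ⌉₊ = 1 := by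
  rw [Nat.ceil_eq_iff one_ne_zero]
  simpa using ⟨h0, h1⟩

lemma rlOpExists_iff {γ : ℝ} (h0 : 0 < γ) (h1 : γ ≤ 1) (g : ℝ → ℂ) :
    RLOpExists γ g ↔ HasRLDeriv γ g (rlOp γ g) := by
  simp only [RLOpExists, HasRLDeriv, rlOp, natCeil_eq_one h0 h1, Nat.cast_one, iteratedDeriv_one,
    Nat.lt_one_iff, forall_eq, iteratedDeriv_zero]
  exact and_congr_right fun _ => forall₂_congr fun y _ =>
    ⟨fun h => h.hasDerivAt, fun h => h.differentiableAt⟩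

lemma HasRLDeriv.eqOn_rlOp {γ : ℝ} (h0 : 0 < γ) (h1 : γ ≤ 1) {g h : ℝ → ℂ}
    (H : HasRLDeriv γ g h) : EqOn (rlOp γ g) h (Ioi 0) := by
  intro y hy
  simp only [rlOp, natCeil_eq_one h0 h1, Nat.cast_one, iteratedDeriv_one]
  exact (H.2 y hy).deriv

/-- The intermediate functions `w k = D^{γ_{k-1}} ⋯ D^{γ_0} (w 0)` of a solution `w 0` of the
equation, described by relations between their values on `(0, ∞)`. -/
structure IsSolutionChain (γ : ℕ → ℝ) (m : ℕ) (s : ℝ) (lam : ℂ) (w : ℕ → ℝ → ℂ) : Prop where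
  hasRLDeriv : ∀ k < m, HasRLDeriv (γ k) (w k) (w (k + 1))
  integralExists : ∀ y, 0 < y → RLIntegralExists (1 - γ m) (w m) y
  integral_eq : ∀ y, 0 < y → rlIntegral (1 - γ m) (w m) y = lam * ((y ^ s : ℝ) : ℂ) * w 0 y

lemma isSolution_iff {γ : ℕ → ℝ} {m : ℕ} (hγ : ∀ k ≤ m, 0 < γ k ∧ γ k ≤ 1) (s : ℝ) (lam : ℂ)
    (u : ℝ → ℂ) : IsSolution γ m s lam u ↔
      ∃ w, EqOn (w 0) u (Ioi 0) ∧ IsSolutionChain γ m s lam w := by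
  -- as `γ m ≤ 1`, the outermost operator is the fractional integral of order `1 - γ m`
  have hceil : ⌈γ m - 1⌉₊ = 0 := Nat.ceil_eq_zero.2 (by linarith [(hγ m le_rfl).2])
  have hexp : ((0 : ℕ) : ℝ) - (γ m - 1) = 1 - γ m := by push_cast; ring
  simp only [IsSolution, DNDerivExists, dnDeriv]
  have hlast : ∀ g, RLOpExists (γ m - 1) g ↔ ∀ y, 0 < y → RLIntegralExists (1 - γ m) g y := by
    intro g
    simp only [RLOpExists, hceil, hexp]
    simp
  have hop : ∀ g, rlOp (γ m - 1) g = rlIntegral (1 - γ m) g := by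
    intro g
    simp only [rlOp, hceil, hexp, iteratedDeriv_zero]
  simp only [hlast, hop]
  constructor
  · rintro ⟨⟨h1, h2⟩, h3⟩
    refine ⟨rlComp γ u, fun y _ => rfl, fun k hk => ?_, h2, h3⟩
    exact (rlOpExists_iff (hγ k hk.le).1 (hγ k hk.le).2 _).1 (h1 k hk)
  · rintro ⟨w, hw0, hw⟩
    have key : ∀ k ≤ m, EqOn (rlComp γ u k) (w k) (Ioi 0) := by
      intro k
      induction k with
      | zero => exact fun _ y hy => (hw0 hy).symm
      | succ k ih =>
        intro hk
        have ih' := ih (by omega)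
        have h := hγ k (by omega)
        exact ((hw.hasRLDeriv k hk).congr (fun y hy => (ih' hy).symm)
          (fun y _ => rfl)).eqOn_rlOp h.1 h.2
    refine ⟨⟨fun k hk => ?_, fun y hy => ?_⟩, fun y hy => ?_⟩
    · have h := hγ k hk.le
      rw [rlOpExists_iff h.1 h.2]
      exact (hw.hasRLDeriv k hk).congr (fun y hy => (key k hk.le hy).symm)
        (fun y hy => (key (k + 1) hk hy).symm)
    · exact (hw.integralExists y hy).congr (fun y hy => (key m le_rfl hy).symm) hy
    · rw [rlIntegral_congr (key m le_rfl) hy, hw.integral_eq y hy, hw0 hy]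

/-! ### Linearity -/

lemma RLIntegralExists.sum {ι : Type*} {S : Finset ι} {β : ℝ} {g : ι → ℝ → ℂ} {y : ℝ}
    (h : ∀ i ∈ S, RLIntegralExists β (g i) y) (d : ι → ℂ) :
    RLIntegralExists β (fun t => ∑ i ∈ S, d i * g i t) y := by
  by_cases hβ : β = 0
  · exact Or.inl hβ
  refine Or.inr ?_
  have hi : ∀ i ∈ S, IntervalIntegrable
      (fun t => d i * (((y - t) ^ (β - 1) : ℝ) • g i t)) volume 0 y :=
    fun i hi => ((h i hi).resolve_left hβ).const_mul _
  refine (IntervalIntegrable.sum S hi).congr fun t _ => ?_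
  simp only [Finset.smul_sum, Finset.sum_apply, Complex.real_smul]
  exact Finset.sum_congr rfl fun i _ => by ring

lemma rlIntegral_sum {ι : Type*} {S : Finset ι} {β : ℝ} {g : ι → ℝ → ℂ} {y : ℝ}
    (h : ∀ i ∈ S, RLIntegralExists β (g i) y) (d : ι → ℂ) :
    rlIntegral β (fun t => ∑ i ∈ S, d i * g i t) y = ∑ i ∈ S, d i * rlIntegral β (g i) y := by
  unfold rlIntegral
  split_ifs with hβ
  · rfl
  have hi : ∀ i ∈ S, IntervalIntegrable
      (fun t => d i * (((y - t) ^ (β - 1) : ℝ) • g i t)) volume 0 y :=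
    fun i hi => ((h i hi).resolve_left hβ).const_mul _
  have : ∀ t : ℝ, ((y - t) ^ (β - 1) : ℝ) • ∑ i ∈ S, d i * g i t =
      ∑ i ∈ S, d i * (((y - t) ^ (β - 1) : ℝ) • g i t) := fun t => by
    simp only [Finset.smul_sum, Complex.real_smul]
    exact Finset.sum_congr rfl fun i _ => by ring
  simp_rw [this]
  rw [intervalIntegral.integral_finsetSum hi, Finset.smul_sum]
  refine Finset.sum_congr rfl fun i _ => ?_
  rw [intervalIntegral.integral_const_mul, mul_smul_comm]

lemma HasRLDeriv.sum {ι : Type*} {S : Finset ι} {γ : ℝ} {g h : ι → ℝ → ℂ}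
    (H : ∀ i ∈ S, HasRLDeriv γ (g i) (h i)) (d : ι → ℂ) :
    HasRLDeriv γ (fun t => ∑ i ∈ S, d i * g i t) (fun t => ∑ i ∈ S, d i * h i t) := by
  refine ⟨fun y hy => RLIntegralExists.sum (fun i hi => (H i hi).1 y hy) d, fun y hy => ?_⟩
  have := HasDerivAt.fun_sum fun i hi => ((H i hi).2 y hy).const_mul (d i)
  refine this.congr_of_eventuallyEq ?_
  filter_upwards [Ioi_mem_nhds hy] with z hz
  exact rlIntegral_sum (fun i hi => (H i hi).1 z hz) d

lemma IsSolution.sum {ι : Type*} {S : Finset ι} {γ : ℕ → ℝ} {m : ℕ}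
    (hγ : ∀ k ≤ m, 0 < γ k ∧ γ k ≤ 1) {s : ℝ} {lam : ℂ} {u : ι → ℝ → ℂ}
    (hu : ∀ i ∈ S, IsSolution γ m s lam (u i)) (d : ι → ℂ) {v : ℝ → ℂ}
    (hv : ∀ y, 0 < y → v y = ∑ i ∈ S, d i * u i y) : IsSolution γ m s lam v := by
  have : ∀ i, ∃ w : ℕ → ℝ → ℂ, i ∈ S → EqOn (w 0) (u i) (Ioi 0) ∧ IsSolutionChain γ m s lam w := by
    intro i
    by_cases hi : i ∈ S
    · obtain ⟨w, hw⟩ := (isSolution_iff hγ s lam _).1 (hu i hi)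
      exact ⟨w, fun _ => hw⟩
    · exact ⟨fun _ _ => 0, fun h => absurd h hi⟩
  choose w hw using this
  rw [isSolution_iff hγ]
  refine ⟨fun k t => ∑ i ∈ S, d i * w i k t, fun y hy => ?_, fun k hk => ?_, fun y hy => ?_,
    fun y hy => ?_⟩
  · simp only
    rw [hv y hy]
    exact Finset.sum_congr rfl fun i hi => by rw [(hw i hi).1 hy]
  · exact HasRLDeriv.sum (fun i hi => (hw i hi).2.hasRLDeriv k hk) d
  · exact RLIntegralExists.sum (fun i hi => (hw i hi).2.integralExists y hy) d
  · rw [rlIntegral_sum (fun i hi => (hw i hi).2.integralExists y hy), Finset.mul_sum]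
    exact Finset.sum_congr rfl fun i hi => by rw [(hw i hi).2.integral_eq y hy]; ring

/-! ### The series `u_k` solve the equation -/

lemma tendsto_add_natCast_mul {c : ℝ} (hc : 0 < c) (b d : ℝ) :
    Tendsto (fun n : ℕ => b + n * c + d) atTop atTop :=
  tendsto_atTop_add_const_right _ _ (tendsto_atTop_add_const_left _ _
    (tendsto_natCast_atTop_atTop.atTop_mul_const hc))

/-- The junk value `Γ(0) = 0`, hence `1 / Γ(0) = 0`, agrees with the entire function `1 / Γ`, so
the recurrence holds at `x = 0` as well. -/
lemma div_Gamma_add_one_mul (a x : ℝ) :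
    a / Real.Gamma (x + 1) * x = a / Real.Gamma x := by
  rcases eq_or_ne x 0 with rfl | hx
  · simp
  · rw [Real.Gamma_add_one hx]
    field_simp

/-- The factor `Γ(e + 1) / Γ(e + 1 - γ)` vanishes at `e = γ - 1`, because `Γ(0) = 0` by
convention: this is the statement that `D^γ y^{γ-1} = 0`. -/
lemma hasRLDeriv_genSeries {a : ℕ → ℂ} (ha : IsEntireSeq a) {b c : ℝ} (hc : 0 < c)
    (h : ∀ n, a n ≠ 0 → -1 < b + n * c) {γ : ℝ} (h1 : γ ≤ 1) :
    (IsEntireSeq fun n => a n * ((Real.Gamma (b + n * c + 1) /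
        Real.Gamma (b + n * c + 1 - γ) : ℝ) : ℂ)) ∧
    HasRLDeriv γ (genSeries a b c) (genSeries (fun n => a n * ((Real.Gamma (b + n * c + 1) /
        Real.Gamma (b + n * c + 1 - γ) : ℝ) : ℂ)) (b - γ) c) := by
  have hβ : 0 ≤ 1 - γ := sub_nonneg.2 h1
  have har := ha.mul_Gamma_ratio (tendsto_add_natCast_mul hc b 1) hβ
  have heq : (fun n : ℕ => a n * ((Real.Gamma (b + n * c + 1) /
      Real.Gamma (b + n * c + 1 - γ) : ℝ) : ℂ)) = fun n => a n * ((Real.Gamma (b + n * c + 1) /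
        Real.Gamma (b + n * c + 1 + (1 - γ)) : ℝ) : ℂ) * ((b + (1 - γ) + n * c : ℝ) : ℂ) := by
    funext n
    rw [mul_assoc, ← Complex.ofReal_mul, ← div_Gamma_add_one_mul]
    congr 4 <;> ring_nf
  rw [heq]
  refine ⟨har.mul_affine _ _, fun y hy => (rlIntegral_genSeries ha hc h hβ hy).1, fun y hy => ?_⟩
  have hd := hasDerivAt_genSeries har (b + (1 - γ)) hc hy
  rw [show b + (1 - γ) - 1 = b - γ by ring] at hd
  refine hd.congr_of_eventuallyEq ?_
  filter_upwards [Ioi_mem_nhds hy] with z hz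
  exact (rlIntegral_genSeries ha hc h hβ hz).2

/-- The coefficients of `u_k`, for `b = α_k`: the exponent of the `n`-th term is
`b + n (α + s)`. -/
noncomputable def fundCoeff (α s b : ℝ) (lam : ℂ) (n : ℕ) : ℂ :=
  ((∏ j ∈ Finset.range n, Real.Gamma ((α + s) * j + s + b + 1) /
    Real.Gamma ((α + s) * j + s + b + 1 + α) : ℝ) : ℂ) * lam ^ n

section fund

variable {α s b : ℝ}

lemma fundCoeff_arg_pos (hα : 0 < α) (hs : 0 ≤ s) (hb : -1 < b) (n : ℕ) :
    0 < (α + s) * n + s + b + 1 := by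
  have : 0 ≤ (α + s) * n := by positivity
  linarith

lemma isEntireSeq_fundCoeff (hα : 0 < α) (hs : 0 ≤ s) (hb : -1 < b) (lam : ℂ) :
    IsEntireSeq (fundCoeff α s b lam) := by
  refine IsEntireSeq.mul_pow (isEntireSeq_prod_Gamma_ratio (fundCoeff_arg_pos hα hs hb) ?_ hα) lam
  refine (tendsto_add_natCast_mul (c := α + s) (by linarith) (s + b) 1).congr fun n => by ring

lemma fundCoeff_zero (lam : ℂ) : fundCoeff α s b lam 0 = 1 := by simp [fundCoeff]

lemma fundCoeff_succ (lam : ℂ) (n : ℕ) : fundCoeff α s b lam (n + 1) = lam * (fundCoeff α s b lam n *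
    ((Real.Gamma ((α + s) * n + s + b + 1) / Real.Gamma ((α + s) * n + s + b + 1 + α) : ℝ) : ℂ)) := by
  rw [fundCoeff, fundCoeff, Finset.prod_range_succ, pow_succ]
  push_cast
  ring

lemma fundCoeff_eq_zero {n : ℕ} (hn : n ≠ 0) : fundCoeff α s b 0 n = 0 := by
  simp [fundCoeff, hn]

end fund

lemma kilbasSaigoCoeff_eq {α s b : ℝ} (hα : 0 < α) (n : ℕ) :
    kilbasSaigoCoeff α ((α + s) / α) ((b + s) / α) n =
      ∏ j ∈ Finset.range n, Real.Gamma ((α + s) * j + s + b + 1) /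
        Real.Gamma ((α + s) * j + s + b + 1 + α) := by
  refine Finset.prod_congr rfl fun j _ => ?_
  congr 2 <;> field_simp <;> ring

lemma fundSol_eq_genSeries {γ : ℕ → ℝ} {m : ℕ} (hα : 0 < dnExp γ m) (s : ℝ) (lam : ℂ) (k : ℕ)
    {y : ℝ} (hy : 0 < y) : fundSol γ m s lam k y =
      genSeries (fundCoeff (dnExp γ m) s (dnExp γ k) lam) (dnExp γ k) (dnExp γ m + s) y := by
  rw [fundSol, kilbasSaigo, genSeries, ← tsum_mul_left]
  refine tsum_congr fun n => ?_
  rw [kilbasSaigoCoeff_eq hα, fundCoeff, rpow_add_nat_mul hy, mul_pow]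
  push_cast
  ring

lemma dnExp_eq (γ : ℕ → ℝ) (k : ℕ) :
    dnExp γ k = ∑ j ∈ Finset.range k, γ j + γ k - 1 := by
  rw [dnExp, Finset.sum_range_succ]

/-- The function `D^{γ_{j-1}} ⋯ D^{γ_0} u_k`, computed term by term, has the coefficients
of `u_k` multiplied by these Gamma factors. -/
noncomputable def chainCoeff (γ : ℕ → ℝ) (c b : ℝ) (a : ℕ → ℂ) : ℕ → ℕ → ℂ
  | 0 => a
  | j + 1 => fun n => chainCoeff γ c b a j n *
      ((Real.Gamma (b - ∑ i ∈ Finset.range j, γ i + n * c + 1) /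
        Real.Gamma (b - ∑ i ∈ Finset.range j, γ i + n * c + 1 - γ j) : ℝ) : ℂ)

lemma chainCoeff_eq_zero {γ : ℕ → ℝ} {c b : ℝ} {a : ℕ → ℂ} {n : ℕ} (h : a n = 0) (j : ℕ) :
    chainCoeff γ c b a j n = 0 := by
  induction j with
  | zero => exact h
  | succ j ih => simp [chainCoeff, ih]

/-- The leading term `y^{α_k}` is annihilated by `D^{γ_k} ⋯ D^{γ_0}`. -/
lemma chainCoeff_zero_eq_zero {γ : ℕ → ℝ} {c : ℝ} {a : ℕ → ℂ} {k j : ℕ} (hkj : k < j) :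
    chainCoeff γ c (dnExp γ k) a j 0 = 0 := by
  induction j, hkj using Nat.le_induction with
  | base =>
    have : dnExp γ k - ∑ i ∈ Finset.range k, γ i + (0 : ℕ) * c + 1 - γ k = 0 := by
      rw [dnExp_eq]; push_cast; ring
    simp only [chainCoeff, this, Real.Gamma_zero, div_zero,
      Complex.ofReal_zero, mul_zero]
  | succ j _ ih => simp [chainCoeff, ih]

lemma chainCoeff_eq {γ : ℕ → ℝ} {c b : ℝ} {a : ℕ → ℂ} {n j : ℕ}
    (h : ∀ i ≤ j, 0 < b - ∑ i ∈ Finset.range i, γ i + n * c + 1) :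
    chainCoeff γ c b a j n = a n * ((Real.Gamma (b + n * c + 1) /
      Real.Gamma (b - ∑ i ∈ Finset.range j, γ i + n * c + 1) : ℝ) : ℂ) := by
  induction j with
  | zero =>
    have := (Real.Gamma_pos_of_pos (h 0 le_rfl)).ne'
    simp only [Finset.range_zero, Finset.sum_empty, sub_zero] at this
    simp [chainCoeff, this]
  | succ j ih =>
    have h0 := (Real.Gamma_pos_of_pos (h j (by omega))).ne'
    simp only [chainCoeff]
    rw [ih fun i hi => h i (by omega), mul_assoc, ← Complex.ofReal_mul,
      Finset.sum_range_succ, div_mul_div_cancel₀ h0]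
    congr 4
    ring

lemma isSolution_fundSol {γ : ℕ → ℝ} {m : ℕ} (hγ : ∀ k ≤ m, 0 < γ k ∧ γ k ≤ 1)
    (hα : 0 < dnExp γ m) {s : ℝ} (hs : 0 ≤ s) {lam : ℂ} {k : ℕ} (hk : k < m)
    (hcond : lam = 0 ∨ 0 < dnExp γ k + s + γ m) :
    IsSolution γ m s lam (fundSol γ m s lam k) := by
  set α := dnExp γ m with hαdef
  set b := dnExp γ k with hbdef
  set c := α + s with hcdef
  have hc : 0 < c := by linarith
  set σ : ℕ → ℝ := fun j => ∑ i ∈ Finset.range j, γ i with hσ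
  have hσm : α = σ m + γ m - 1 := dnExp_eq γ m
  have hbk : b = σ k + γ k - 1 := dnExp_eq γ k
  have hσmono : ∀ i j, i ≤ j → j ≤ m → σ i ≤ σ j := fun i j hij hj =>
    Finset.sum_le_sum_of_subset_of_nonneg (Finset.range_subset_range.2 hij) fun l hl _ =>
      (hγ l (by have := Finset.mem_range.1 hl; omega)).1.le
  have hσ0 : 0 ≤ σ k := by simpa [hσ] using hσmono 0 k (by omega) hk.le
  have hγk := hγ k hk.le
  have hb : -1 < b := by linarith
  set a := fundCoeff α s b lam with ha
  have haE : IsEntireSeq a := isEntireSeq_fundCoeff hα hs hb lam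
  set A := chainCoeff γ c b a with hA
  -- all exponents except the leading one stay above `-1`
  have hpos : lam ≠ 0 → ∀ n : ℕ, ∀ j ≤ m, 0 < b - σ j + (n + 1 : ℕ) * c + 1 := by
    intro hlam n j hj
    have h1 := hcond.resolve_left hlam
    have h2 := hσmono j m hj le_rfl
    have h3 : 0 ≤ n * c := by positivity
    push_cast
    linarith
  have hA0 : lam = 0 → ∀ n j, A j (n + 1) = 0 := fun hlam n j =>
    chainCoeff_eq_zero (by rw [ha, hlam, fundCoeff_eq_zero n.succ_ne_zero]) j
  have hexp : ∀ j ≤ m, ∀ n, A j n ≠ 0 → -1 < b - σ j + n * c := by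
    intro j hj n hn
    cases n with
    | zero =>
      have hjk : j ≤ k := by
        by_contra hlt
        exact hn (chainCoeff_zero_eq_zero (by omega))
      have := hσmono j k hjk hk.le
      push_cast
      linarith
    | succ n =>
      have := hpos (fun h => hn (hA0 h n j)) n j hj
      linarith
  have hstep : ∀ j < m, IsEntireSeq (A j) → IsEntireSeq (A (j + 1)) ∧
      HasRLDeriv (γ j) (genSeries (A j) (b - σ j) c)
        (genSeries (A (j + 1)) (b - σ (j + 1)) c) := by
    intro j hj hE
    have := hasRLDeriv_genSeries hE hc (hexp j hj.le) (hγ j hj.le).2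
    rw [show b - σ (j + 1) = b - σ j - γ j by simp only [hσ, Finset.sum_range_succ]; ring]
    exact this
  have hE : ∀ j ≤ m, IsEntireSeq (A j) := by
    intro j
    induction j with
    | zero => exact fun _ => haE
    | succ j ih => exact fun hj => (hstep j hj (ih (by omega))).1
  rw [isSolution_iff hγ]
  have hlast := fun y (hy : 0 < y) => rlIntegral_genSeries (hE m le_rfl) hc (hexp m le_rfl)
    (sub_nonneg.2 (hγ m le_rfl).2) hy
  have hEl := (hE m le_rfl).mul_Gamma_ratio (tendsto_add_natCast_mul hc (b - σ m) 1)
    (sub_nonneg.2 (hγ m le_rfl).2)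
  refine ⟨fun j => genSeries (A j) (b - σ j) c, fun y hy => ?_, fun j hj =>
    (hstep j hj (hE j hj.le)).2, fun y hy => (hlast y hy).1, fun y hy => ?_⟩
  · rw [fundSol_eq_genSeries hα s lam k hy]
    change genSeries (A 0) (b - σ 0) c y = genSeries a b c y
    simp [hσ, hA, chainCoeff]
  · rw [(hlast y hy).2, genSeries_eq_add_shift hEl _ _ hy, hA, chainCoeff_zero_eq_zero hk]
    simp only [zero_mul, zero_add]
    rw [mul_assoc, rpow_mul_genSeries _ _ _ _ hy, genSeries, genSeries, ← tsum_mul_left]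
    refine tsum_congr fun n => ?_
    rw [← mul_assoc, show b - σ m + (1 - γ m) + c + n * c = b - σ 0 + s + n * c by
      simp [hσ] at *; linarith]
    congr 1
    by_cases hlam : lam = 0
    · have := hA0 hlam n m
      rw [hA] at this
      rw [this, hlam]
      simp
    · rw [chainCoeff_eq (hpos hlam n), mul_assoc, ← Complex.ofReal_mul]
      have h0 := (Real.Gamma_pos_of_pos (hpos hlam n m le_rfl)).ne'
      rw [div_mul_div_cancel₀ h0, ha, fundCoeff_succ, mul_assoc, mul_assoc, ← Complex.ofReal_mul]
      have e1 : c * n + s + b + 1 = b - σ m + (n + 1 : ℕ) * c + 1 + (1 - γ m) := by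
        push_cast; linarith
      have e2 : c * n + s + b + 1 + α = b + (n + 1 : ℕ) * c + 1 := by
        push_cast; linarith
      rw [e2, ← e1]
      have p1 := (Real.Gamma_pos_of_pos (fundCoeff_arg_pos hα hs hb n)).ne'
      have p2 : Real.Gamma (b + (n + 1 : ℕ) * c + 1) ≠ 0 := by
        rw [← e2]
        exact (Real.Gamma_pos_of_pos (by linarith [fundCoeff_arg_pos hα hs hb n])).ne'
      rw [div_mul_div_cancel₀ p2, div_self p1]
      simp [chainCoeff]

/-! ### Fractional integrals as convolutions -/

/-- Integrability on every bounded interval `(0, Y)`. -/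
def LocInt (g : ℝ → ℂ) : Prop := ∀ Y, 0 < Y → IntervalIntegrable g volume 0 Y

lemma LocInt.integrableOn {g : ℝ → ℂ} (hg : LocInt g) {Y : ℝ} (hY : 0 < Y) :
    IntegrableOn g (Ioo 0 Y) :=
  ((intervalIntegrable_iff_integrableOn_Ioo_of_le hY.le).1 (hg Y hY))

lemma LocInt.add {g h : ℝ → ℂ} (hg : LocInt g) (hh : LocInt h) : LocInt fun t => g t + h t :=
  fun Y hY => (hg Y hY).add (hh Y hY)

lemma LocInt.const_mul {g : ℝ → ℂ} (hg : LocInt g) (d : ℂ) : LocInt fun t => d * g t :=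
  fun Y hY => (hg Y hY).const_mul d

lemma LocInt.sub {g h : ℝ → ℂ} (hg : LocInt g) (hh : LocInt h) : LocInt fun t => g t - h t :=
  fun Y hY => (hg Y hY).sub (hh Y hY)

lemma LocInt.congr_ae {g h : ℝ → ℂ} (hg : LocInt g) (hgh : g =ᵐ[volume.restrict (Ioi 0)] h) :
    LocInt h := fun Y hY => by
  have := hg Y hY
  rw [intervalIntegrable_iff_integrableOn_Ioc_of_le hY.le] at this ⊢
  exact this.congr (ae_restrict_of_ae_restrict_of_subset Ioc_subset_Ioi_self hgh)

lemma LocInt.sum {ι : Type*} {S : Finset ι} {g : ι → ℝ → ℂ} (hg : ∀ i ∈ S, LocInt (g i)) :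
    LocInt fun t => ∑ i ∈ S, g i t := fun Y hY => by
  have := IntervalIntegrable.sum S fun i hi => hg i hi Y hY
  refine this.congr fun t _ => ?_
  simp

lemma LocInt.rpow_mul {g : ℝ → ℂ} (hg : LocInt g) {s : ℝ} (hs : 0 ≤ s) (lam : ℂ) :
    LocInt fun t => lam * ((t ^ s : ℝ) : ℂ) * g t := fun Y hY =>
  (hg Y hY).continuousOn_mul
    ((continuous_const.mul (Complex.continuous_ofReal.comp
      (Real.continuous_rpow_const hs))).continuousOn)

lemma locInt_rpow {x : ℝ} (hx : -1 < x) : LocInt fun t => ((t ^ x : ℝ) : ℂ) := fun Y _ => by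
  have := intervalIntegral.intervalIntegrable_rpow' (a := 0) (b := Y) hx
  exact ⟨this.1.ofReal, this.2.ofReal⟩

/-- Existence of one fractional integral forces integrability near `0`: on `(0, Y)` the kernel of
the integral up to `2Y` is bounded away from `0`. -/
lemma LocInt.of_rlIntegralExists {β : ℝ} (hβ : β ≠ 0) {g : ℝ → ℂ}
    (h : ∀ y, 0 < y → RLIntegralExists β g y) : LocInt g := by
  intro Y hY
  have h2 := (h (2 * Y) (by linarith)).resolve_left hβ
  have h3 := h2.mono_set (c := 0) (d := Y) (by
    rw [uIcc_of_le hY.le, uIcc_of_le (by linarith)]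
    exact Icc_subset_Icc_right (by linarith))
  have hc : ContinuousOn (fun t => (((2 * Y - t) ^ (1 - β) : ℝ) : ℂ)) (uIcc 0 Y) := by
    intro t ht
    rw [uIcc_of_le hY.le] at ht
    exact (Complex.continuous_ofReal.continuousAt.comp
      (ContinuousAt.rpow_const (f := fun t : ℝ => 2 * Y - t) (by fun_prop)
        (Or.inl (by linarith [ht.2])))).continuousWithinAt
  refine (h3.continuousOn_mul hc).congr fun t ht => ?_
  rw [uIoc_of_le hY.le] at ht
  have : (2 * Y - t) ^ (1 - β) * (2 * Y - t) ^ (β - 1) = 1 := by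
    rw [← Real.rpow_add (by linarith [ht.2])]
    simp
  simp only [Complex.real_smul]
  rw [← mul_assoc, ← Complex.ofReal_mul, this, Complex.ofReal_one, one_mul]

/-- The kernel `t_+^{β-1} / Γ(β)`. -/
noncomputable def rlKernel (β : ℝ) : ℝ → ℝ :=
  indicator (Ioi 0) fun t => t ^ (β - 1) / Real.Gamma β

/-- The complex-valued kernel `t_+^{β-1} / Γ(β)`. -/
noncomputable def rlKernelC (β : ℝ) : ℝ → ℂ :=
  indicator (Ioi 0) fun t => ((t ^ (β - 1) / Real.Gamma β : ℝ) : ℂ)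

lemma rlKernelC_eq (β t : ℝ) : rlKernelC β t = (rlKernel β t : ℂ) := by
  by_cases h : t ∈ Ioi (0 : ℝ) <;> simp [rlKernelC, rlKernel, h]

lemma rlKernel_nonneg {β : ℝ} (hβ : 0 < β) (t : ℝ) : 0 ≤ rlKernel β t :=
  indicator_nonneg (fun _ ht => div_nonneg (Real.rpow_nonneg (le_of_lt ht) _)
    (Real.Gamma_pos_of_pos hβ).le) t

lemma norm_rlKernelC {β : ℝ} (hβ : 0 < β) (t : ℝ) : ‖rlKernelC β t‖ = rlKernel β t := by
  rw [rlKernelC_eq, Complex.norm_real, Real.norm_of_nonneg (rlKernel_nonneg hβ t)]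

lemma measurable_rlKernelC (β : ℝ) : Measurable (rlKernelC β) :=
  (Complex.measurable_ofReal.comp ((measurable_id.pow_const _).div_const _)).indicator
    measurableSet_Ioi

open ContinuousLinearMap (mul)

lemma indicator_mul_indicator_sub {A : Type*} [MulZeroClass A] (f g : ℝ → A) (x t : ℝ) :
    indicator (Ioi 0) f t * indicator (Ioi 0) g (x - t) =
      indicator (Ioo 0 x) (fun t => f t * g (x - t)) t := by
  by_cases h1 : 0 < t <;> by_cases h2 : t < x <;> simp [indicator, h1, h2]

lemma indicator_rlIntegral {β : ℝ} (hβ : β ≠ 0) (g : ℝ → ℂ) :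
    indicator (Ioi 0) (rlIntegral β g) =
      convolution (indicator (Ioi 0) g) (rlKernelC β) (mul ℝ ℂ) volume := by
  rw [rlKernelC, ← posConvolution_eq_convolution_indicator _ _ (mul ℝ ℂ) volume, posConvolution]
  congr 1
  funext y
  rw [rlIntegral, if_neg hβ, ← intervalIntegral.integral_smul]
  congr 1
  funext t
  simp only [Complex.real_smul, ContinuousLinearMap.mul_apply']
  push_cast
  ring

lemma rlIntegral_eq_convolution {β : ℝ} (hβ : β ≠ 0) (g : ℝ → ℂ) {y : ℝ} (hy : 0 < y) :
    rlIntegral β g y =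
      convolution (indicator (Ioi 0) g) (rlKernelC β) (mul ℝ ℂ) volume y := by
  rw [← indicator_rlIntegral hβ, indicator_of_mem (mem_Ioi.2 hy)]

lemma convolutionExistsAt_rlKernel {a b : ℝ} (ha : 0 < a) (hb : 0 < b) (x : ℝ) :
    ConvolutionExistsAt (rlKernel b) (rlKernel a) x (mul ℝ ℝ) volume := by
  unfold ConvolutionExistsAt
  simp only [ContinuousLinearMap.mul_apply', rlKernel, indicator_mul_indicator_sub]
  rw [integrable_indicator_iff measurableSet_Ioo]
  rcases le_or_gt x 0 with hx | hx
  · simp [Ioo_eq_empty (not_lt.2 hx)]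
  have := (intervalIntegrable_iff_integrableOn_Ioo_of_le hx.le).1
    ((rpow_mul_rpow_sub_integrable hb ha hx).const_mul ((Real.Gamma a)⁻¹ * (Real.Gamma b)⁻¹))
  refine this.congr_fun (fun t _ => ?_) measurableSet_Ioo
  simp only [div_eq_mul_inv]
  ring

lemma convolution_rlKernel {a b : ℝ} (ha : 0 < a) (hb : 0 < b) :
    convolution (rlKernel b) (rlKernel a) (mul ℝ ℝ) volume = rlKernel (b + a) := by
  have h1 := (Real.Gamma_pos_of_pos ha).ne'
  have h2 := (Real.Gamma_pos_of_pos hb).ne'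
  rw [rlKernel, rlKernel, ← posConvolution_eq_convolution_indicator _ _ (mul ℝ ℝ) volume,
    posConvolution, rlKernel]
  funext x
  by_cases hx : x ∈ Ioi (0 : ℝ)
  · rw [indicator_of_mem hx, indicator_of_mem hx]
    have : ∀ t, mul ℝ ℝ (t ^ (b - 1) / Real.Gamma b) ((x - t) ^ (a - 1) / Real.Gamma a) =
        ((Real.Gamma a)⁻¹ * (Real.Gamma b)⁻¹) * ((x - t) ^ (a - 1) * t ^ (b - 1)) := fun t => by
      simp only [ContinuousLinearMap.mul_apply', div_eq_mul_inv]
      ring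
    simp_rw [this]
    rw [intervalIntegral.integral_const_mul, integral_rpow_mul_rpow_sub hb ha hx]
    field_simp
  · rw [indicator_of_notMem hx, indicator_of_notMem hx]

lemma convolution_rlKernelC {a b : ℝ} (ha : 0 < a) (hb : 0 < b) :
    convolution (rlKernelC b) (rlKernelC a) (mul ℝ ℂ) volume = rlKernelC (b + a) := by
  funext x
  rw [rlKernelC_eq, ← convolution_rlKernel ha hb, convolution_def, convolution_def]
  simp only [ContinuousLinearMap.mul_apply', rlKernelC_eq, ← Complex.ofReal_mul]
  exact integral_ofReal

/-- On `(-∞, N)` the convolution only involves the restrictions of both factors to `(0, N)`. -/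
lemma indicator_mul_indicator_sub_of_lt {f k : ℝ → ℂ} {N x : ℝ} (hx : x < N) (t : ℝ) :
    indicator (Ioi 0) f t * indicator (Ioi 0) k (x - t) =
      indicator (Ioo 0 N) f t * indicator (Ioo 0 N) k (x - t) := by
  by_cases h1 : 0 < t <;> by_cases h2 : t < x
  · simp [indicator, h1, h2, show t < N by linarith,
      show x - t < N by linarith]
  all_goals simp [indicator, h1, h2]

lemma integrable_rlKernelC_Ioo {β : ℝ} (hβ : 0 < β) {N : ℝ} (hN : 0 < N) :
    Integrable (indicator (Ioo 0 N) fun t => ((t ^ (β - 1) / Real.Gamma β : ℝ) : ℂ)) := by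
  rw [integrable_indicator_iff measurableSet_Ioo]
  have := ((intervalIntegrable_iff_integrableOn_Ioo_of_le hN.le).1
    (intervalIntegral.intervalIntegrable_rpow' (a := 0) (b := N) (r := β - 1)
      (by linarith))).div_const (Real.Gamma β)
  exact this.ofReal

lemma LocInt.ae_convolutionExistsAt {g : ℝ → ℂ} (hg : LocInt g) {β : ℝ} (hβ : 0 < β) :
    ∀ᵐ y, ConvolutionExistsAt (indicator (Ioi 0) g) (rlKernelC β) y (mul ℝ ℂ) volume := by
  have : ∀ᵐ y, ∀ n : ℕ, ConvolutionExistsAt (indicator (Ioo 0 ((n : ℝ) + 1)) g)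
      (indicator (Ioo 0 ((n : ℝ) + 1)) fun t => ((t ^ (β - 1) / Real.Gamma β : ℝ) : ℂ)) y
      (mul ℝ ℂ) volume := by
    rw [ae_all_iff]
    intro n
    have hn : (0 : ℝ) < n + 1 := by positivity
    exact ((integrable_indicator_iff measurableSet_Ioo).2
      (hg.integrableOn hn)).ae_convolution_exists _ (integrable_rlKernelC_Ioo hβ hn)
  filter_upwards [this] with y hy
  obtain ⟨n, hn⟩ := exists_nat_gt y
  refine (hy n).congr (Eventually.of_forall fun t => ?_)
  simp only [ContinuousLinearMap.mul_apply', rlKernelC]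
  exact (indicator_mul_indicator_sub_of_lt (by linarith) t).symm

lemma RLIntegralExists.of_convolutionExistsAt {β : ℝ} {g : ℝ → ℂ} {y : ℝ} (hy : 0 < y)
    (hβ : 0 < β)
    (h : ConvolutionExistsAt (indicator (Ioi 0) g) (rlKernelC β) y (mul ℝ ℂ) volume) :
    RLIntegralExists β g y := by
  refine Or.inr ?_
  unfold ConvolutionExistsAt at h
  simp only [ContinuousLinearMap.mul_apply', rlKernelC, indicator_mul_indicator_sub] at h
  rw [integrable_indicator_iff measurableSet_Ioo] at h
  rw [intervalIntegrable_iff_integrableOn_Ioo_of_le hy.le]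
  have hG : (Real.Gamma β : ℂ) ≠ 0 := by exact_mod_cast (Real.Gamma_pos_of_pos hβ).ne'
  refine (h.const_mul (Real.Gamma β : ℂ)).congr (Eventually.of_forall fun t => ?_)
  simp only [Complex.real_smul]
  push_cast
  field_simp

lemma LocInt.ae_rlIntegralExists {g : ℝ → ℂ} (hg : LocInt g) {β : ℝ} (hβ : 0 ≤ β) :
    ∀ᵐ y ∂(volume.restrict (Ioi 0)), RLIntegralExists β g y := by
  rcases hβ.eq_or_lt with rfl | hβ
  · exact Eventually.of_forall fun y => Or.inl rfl
  rw [ae_restrict_iff' measurableSet_Ioi]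
  filter_upwards [hg.ae_convolutionExistsAt hβ] with y hy hy0
  exact RLIntegralExists.of_convolutionExistsAt hy0 hβ hy

lemma LocInt.rlIntegral {g : ℝ → ℂ} (hg : LocInt g) {β : ℝ} (hβ : 0 ≤ β) :
    LocInt (rlIntegral β g) := by
  rcases hβ.eq_or_lt with rfl | hβ
  · convert! hg using 1
    funext y
    simp [DN.rlIntegral]
  intro Y hY
  rw [intervalIntegrable_iff_integrableOn_Ioo_of_le hY.le]
  have := ((integrable_indicator_iff measurableSet_Ioo).2
    (hg.integrableOn hY)).integrable_convolution (mul ℝ ℂ) (integrable_rlKernelC_Ioo hβ hY)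
  refine this.integrableOn.congr_fun (fun y hy => ?_) measurableSet_Ioo
  rw [rlIntegral_eq_convolution hβ.ne' _ hy.1, convolution_def, convolution_def]
  congr 1
  funext t
  simp only [ContinuousLinearMap.mul_apply', rlKernelC]
  exact (indicator_mul_indicator_sub_of_lt hy.2 t).symm

/-- The semigroup property `I^a I^b = I^{b+a}` of fractional integration. -/
lemma LocInt.rlIntegral_rlIntegral {g : ℝ → ℂ} (hg : LocInt g) {a b : ℝ} (ha : 0 ≤ a)
    (hb : 0 ≤ b) : DN.rlIntegral a (DN.rlIntegral b g) =ᵐ[volume.restrict (Ioi 0)]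
      DN.rlIntegral (b + a) g := by
  rcases ha.eq_or_lt with rfl | ha
  · refine Eventually.of_forall fun y => ?_
    rw [add_zero, DN.rlIntegral, if_pos rfl]
  rcases hb.eq_or_lt with rfl | hb
  · refine Eventually.of_forall fun y => ?_
    rw [zero_add]
    congr 1
    funext t
    rw [DN.rlIntegral, if_pos rfl]
  have hmeas : AEStronglyMeasurable (indicator (Ioi 0) g) volume := by
    rw [aestronglyMeasurable_indicator_iff measurableSet_Ioi,
      show Ioi (0 : ℝ) = ⋃ n : ℕ, Ioo (0 : ℝ) (n + 1) by
        ext t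
        simp only [mem_Ioi, mem_iUnion, mem_Ioo, exists_and_left, iff_self_and]
        intro _
        obtain ⟨n, hn⟩ := exists_nat_gt t
        exact ⟨n, by linarith⟩]
    exact AEStronglyMeasurable.iUnion fun n => (hg.integrableOn (by positivity)).1
  change ∀ᵐ y ∂_, _
  rw [ae_restrict_iff' measurableSet_Ioi]
  filter_upwards [hg.ae_convolutionExistsAt (add_pos hb ha)] with y hy hy0
  rw [rlIntegral_eq_convolution ha.ne' _ hy0, indicator_rlIntegral hb.ne',
    rlIntegral_eq_convolution (add_pos hb ha).ne' _ hy0, ← convolution_rlKernelC ha hb]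
  refine convolution_assoc _ _ _ _ (fun x y z => by simp [mul_assoc]) hmeas
    (measurable_rlKernelC b).aestronglyMeasurable (measurable_rlKernelC a).aestronglyMeasurable
    (hg.ae_convolutionExistsAt hb) ?_ ?_
  · simp_rw [norm_rlKernelC ha, norm_rlKernelC hb]
    exact Eventually.of_forall fun x => convolutionExistsAt_rlKernel ha hb x
  · simp_rw [norm_rlKernelC ha, norm_rlKernelC hb]
    rw [convolution_rlKernel ha hb]
    have := hy.norm
    refine this.congr (Eventually.of_forall fun t => ?_)
    simp only [ContinuousLinearMap.mul_apply', norm_mul, norm_rlKernelC (add_pos hb ha)]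

lemma rlIntegral_congr_ae {β : ℝ} {g h : ℝ → ℂ} (hgh : g =ᵐ[volume.restrict (Ioi 0)] h) :
    rlIntegral β g =ᵐ[volume.restrict (Ioi 0)] rlIntegral β h := by
  by_cases hβ : β = 0
  · filter_upwards [hgh] with y hy
    simp [rlIntegral, hβ, hy]
  · filter_upwards [ae_restrict_mem measurableSet_Ioi] with y hy
    simp only [rlIntegral, if_neg hβ]
    congr 1
    rw [intervalIntegral.integral_of_le (le_of_lt hy), intervalIntegral.integral_of_le (le_of_lt hy)]
    refine integral_congr_ae ?_
    filter_upwards [ae_restrict_of_ae_restrict_of_subset Ioc_subset_Ioi_self hgh] with t ht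
    rw [ht]

lemma rlIntegral_add {β : ℝ} {g h : ℝ → ℂ} {y : ℝ} (hg : RLIntegralExists β g y)
    (hh : RLIntegralExists β h y) :
    rlIntegral β (fun t => g t + h t) y = rlIntegral β g y + rlIntegral β h y := by
  unfold rlIntegral
  split_ifs with hβ
  · rfl
  · simp_rw [smul_add]
    rw [intervalIntegral.integral_add (hg.resolve_left hβ) (hh.resolve_left hβ), smul_add]

lemma rlIntegral_const_mul (β : ℝ) (d : ℂ) (g : ℝ → ℂ) (y : ℝ) :
    rlIntegral β (fun t => d * g t) y = d * rlIntegral β g y := by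
  unfold rlIntegral
  split_ifs with hβ
  · rfl
  · rw [mul_smul_comm, ← intervalIntegral.integral_const_mul]
    simp_rw [mul_smul_comm]

lemma LocInt.rlIntegral_add {g h : ℝ → ℂ} (hg : LocInt g) (hh : LocInt h) {β : ℝ} (hβ : 0 ≤ β) :
    DN.rlIntegral β (fun t => g t + h t) =ᵐ[volume.restrict (Ioi 0)]
      fun y => DN.rlIntegral β g y + DN.rlIntegral β h y := by
  filter_upwards [hg.ae_rlIntegralExists hβ, hh.ae_rlIntegralExists hβ] with y h1 h2
  exact DN.rlIntegral_add h1 h2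

lemma rlIntegral_rpow {x β : ℝ} (hx : 0 < x) (hβ : 0 ≤ β) {y : ℝ} (hy : 0 < y) :
    rlIntegral β (fun t => ((t ^ (x - 1) : ℝ) : ℂ)) y =
      ((Real.Gamma x / Real.Gamma (x + β) * y ^ (x + β - 1) : ℝ) : ℂ) := by
  rcases hβ.eq_or_lt with rfl | hβ
  · simp [rlIntegral, (Real.Gamma_pos_of_pos hx).ne']
  · have h1 := (Real.Gamma_pos_of_pos hβ).ne'
    have h2 := (Real.Gamma_pos_of_pos (add_pos hx hβ)).ne'
    rw [rlIntegral, if_neg hβ.ne']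
    simp only [Complex.real_smul, ← Complex.ofReal_mul]
    rw [intervalIntegral.integral_ofReal, integral_rpow_mul_rpow_sub hx hβ hy, ← Complex.ofReal_mul]
    congr 1
    field_simp

lemma rlIntegral_one (g : ℝ → ℂ) (y : ℝ) : rlIntegral 1 g y = ∫ t in (0 : ℝ)..y, g t := by
  simp [rlIntegral]

/-! ### Inverting a Riemann–Liouville derivative -/

/-- Injectivity of the primitive, from Lebesgue's differentiation theorem. -/
lemma LocInt.ae_eq_zero {v : ℝ → ℂ} (hv : LocInt v)
    (h : ∀ᵐ y ∂(volume.restrict (Ioi 0)), ∫ t in (0 : ℝ)..y, v t = 0) :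
    v =ᵐ[volume.restrict (Ioi 0)] 0 := by
  have hcont : ContinuousOn (fun y => ∫ t in (0 : ℝ)..y, v t) (Ioi 0) := by
    intro y hy
    have hy' : 0 < y := hy
    have h2 := intervalIntegral.continuousOn_primitive_interval'
      (hv (y + 1) (by linarith)) left_mem_uIcc
    refine ((h2.continuousAt ?_)).continuousWithinAt
    rw [uIcc_of_le (by linarith)]
    exact Icc_mem_nhds hy (by linarith)
  have hzero : EqOn (fun y => ∫ t in (0 : ℝ)..y, v t) (fun _ => 0) (Ioi 0) :=
    Measure.eqOn_open_of_ae_eq h isOpen_Ioi hcont continuousOn_const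
  have hder : ∀ᵐ x : ℝ, ∀ n : ℕ, x ∈ uIcc (0 : ℝ) (n + 1) → ∀ c ∈ uIcc (0 : ℝ) (n + 1),
      HasDerivAt (fun x => ∫ t in c..x, v t) (v x) x :=
    ae_all_iff.2 fun n => (hv (n + 1) (by positivity)).ae_hasDerivAt_integral
  change ∀ᵐ y ∂_, _
  rw [ae_restrict_iff' measurableSet_Ioi]
  filter_upwards [hder] with x hx hx0
  obtain ⟨n, hn⟩ := exists_nat_gt x
  have hx0' : 0 < x := hx0
  have h1 := hx n (by rw [uIcc_of_le (by linarith)]; exact ⟨hx0'.le, by linarith⟩) 0 left_mem_uIcc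
  have h2 : HasDerivAt (fun x => ∫ t in (0 : ℝ)..x, v t) 0 x := by
    refine (hasDerivAt_const x (0 : ℂ)).congr_of_eventuallyEq ?_
    filter_upwards [Ioi_mem_nhds hx0'] with z hz
    exact hzero hz
  exact h1.unique h2

/-- If `w' = D^γ w` is integrable near `0`, then so is `w`, and `w` is recovered from `w'` up to
the kernel `y^{γ-1}` of `D^γ`. -/
lemma HasRLDeriv.exists_ae_eq {γ : ℝ} (h0 : 0 < γ) (h1 : γ ≤ 1) {w w' : ℝ → ℂ}
    (H : HasRLDeriv γ w w') (hw' : LocInt w') : LocInt w ∧ ∃ b : ℂ,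
      w =ᵐ[volume.restrict (Ioi 0)]
        fun y => b * ((y ^ (γ - 1) : ℝ) : ℂ) + rlIntegral γ w' y := by
  have hone : LocInt fun _ => (1 : ℂ) := fun Y _ => intervalIntegrable_const
  -- the fundamental theorem of calculus; `γ = 1` is included, the integral of order `0` being `w`
  obtain ⟨b, hb⟩ : ∃ b : ℂ, EqOn (rlIntegral (1 - γ) w) (fun y => b * 1 + rlIntegral 1 w' y)
      (Ioi 0) := by
    refine ⟨rlIntegral (1 - γ) w 1 - ∫ t in (0 : ℝ)..1, w' t, fun y hy => ?_⟩
    have hy' : 0 < y := hy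
    have hi := (hw' 1 one_pos).symm.trans (hw' y hy')
    have := intervalIntegral.integral_eq_sub_of_hasDerivAt (fun x hx => H.2 x ?_) hi
    · rw [← intervalIntegral.integral_interval_sub_left (hw' y hy') (hw' 1 one_pos)] at this
      simp only [rlIntegral_one]
      linear_combination -this
    · have : min 1 y ≤ x := hx.1
      exact (lt_min one_pos hy').trans_le this
  have hbae : rlIntegral (1 - γ) w =ᵐ[volume.restrict (Ioi 0)]
      fun y => b * 1 + rlIntegral 1 w' y := by
    filter_upwards [ae_restrict_mem measurableSet_Ioi] with y hy using hb hy
  have hI1 : LocInt (rlIntegral 1 w') := hw'.rlIntegral zero_le_one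
  have hw : LocInt w := by
    rcases eq_or_ne (1 - γ) 0 with hγ | hγ
    · refine ((hone.const_mul b).add hI1).congr_ae ?_
      filter_upwards [hbae] with y hy
      rw [← hy, rlIntegral, if_pos hγ]
    · exact LocInt.of_rlIntegralExists hγ H.1
  refine ⟨hw, b / Real.Gamma γ, ?_⟩
  set h : ℝ → ℂ := fun y => b / Real.Gamma γ * ((y ^ (γ - 1) : ℝ) : ℂ) + rlIntegral γ w' y with hh
  have hpow : LocInt fun y => b / Real.Gamma γ * ((y ^ (γ - 1) : ℝ) : ℂ) :=
    (locInt_rpow (by linarith)).const_mul _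
  have hIγ : LocInt (rlIntegral γ w') := hw'.rlIntegral h0.le
  have hhloc : LocInt h := hpow.add hIγ
  -- Both `I^1 w = I^γ I^{1-γ} w` and `I^1 h` equal `b y^γ / Γ(γ+1) + I^{1+γ} w'`.
  have hL : rlIntegral 1 w =ᵐ[volume.restrict (Ioi 0)]
      fun y => b * (((Real.Gamma 1 / Real.Gamma (1 + γ) * y ^ (1 + γ - 1) : ℝ)) : ℂ) +
        rlIntegral (1 + γ) w' y := by
    have e1 := hw.rlIntegral_rlIntegral h0.le (sub_nonneg.2 h1)
    rw [sub_add_cancel] at e1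
    have e2 := rlIntegral_congr_ae (β := γ) hbae
    have e3 := (hone.const_mul b).rlIntegral_add hI1 h0.le
    have e4 := hw'.rlIntegral_rlIntegral h0.le zero_le_one
    filter_upwards [e1, e2, e3, e4, ae_restrict_mem measurableSet_Ioi] with y k1 k2 k3 k4 hy
    rw [← k1, k2, k3, k4, rlIntegral_const_mul]
    have := rlIntegral_rpow (x := 1) one_pos h0.le hy
    simp only [sub_self, Real.rpow_zero, Complex.ofReal_one] at this
    rw [this]
  have hR : rlIntegral 1 h =ᵐ[volume.restrict (Ioi 0)]
      fun y => b * (((Real.Gamma 1 / Real.Gamma (1 + γ) * y ^ (1 + γ - 1) : ℝ)) : ℂ) +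
        rlIntegral (1 + γ) w' y := by
    have e3 := hpow.rlIntegral_add hIγ zero_le_one
    have e4 := hw'.rlIntegral_rlIntegral zero_le_one h0.le
    filter_upwards [e3, e4, ae_restrict_mem measurableSet_Ioi] with y k3 k4 hy
    rw [hh, k3, k4, rlIntegral_const_mul, rlIntegral_rpow h0 zero_le_one hy, add_comm γ 1]
    have hG : (Real.Gamma γ : ℂ) ≠ 0 := by exact_mod_cast (Real.Gamma_pos_of_pos h0).ne'
    congr 1
    rw [Real.Gamma_one]
    push_cast
    field_simp
  have hz := (hw.sub hhloc).ae_eq_zero (by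
    filter_upwards [hL, hR, ae_restrict_mem measurableSet_Ioi] with y k1 k2 hy
    rw [intervalIntegral.integral_sub (hw y hy) (hhloc y hy), ← rlIntegral_one, ← rlIntegral_one,
      k1, k2, sub_self])
  filter_upwards [hz] with y hy
  exact sub_eq_zero.1 hy

/-! ### Solutions are integrable near the origin -/

/-- When all `γ_k` equal `1` the equation is the ordinary differential equation
`u^{(m)} = λ y^s u`, and Grönwall's inequality bounds `(u, …, u^{(m-1)})` on `(0, 1]`. -/
lemma IsSolutionChain.locInt_of_forall_eq_one {γ : ℕ → ℝ} {m : ℕ} (hm : 0 < m)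
    (hγ : ∀ k ≤ m, γ k = 1) {s : ℝ} (hs : 0 ≤ s) {lam : ℂ} {w : ℕ → ℝ → ℂ}
    (hw : IsSolutionChain γ m s lam w) : LocInt (w 0) := by
  have hzero : ∀ g, rlIntegral 0 g = g := fun g => by funext y; simp [rlIntegral]
  have hd : ∀ k < m, ∀ y, 0 < y → HasDerivAt (w k) (w (k + 1) y) y := fun k hk y hy => by
    have := (hw.hasRLDeriv k hk).2 y hy
    rwa [hγ k hk.le, sub_self, hzero] at this
  have he : ∀ y, 0 < y → w m y = lam * ((y ^ s : ℝ) : ℂ) * w 0 y := fun y hy => by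
    have := hw.integral_eq y hy
    rwa [hγ m le_rfl, sub_self, hzero] at this
  -- Grönwall's inequality runs forward in time, hence the reflection `y = 1 - t`
  set X : ℝ → Fin m → ℂ := fun t k => w k (1 - t) with hX
  set X' : ℝ → Fin m → ℂ := fun t k => -w (k + 1) (1 - t) with hX'
  set K := 1 + ‖lam‖ with hK
  have hder : ∀ t < 1, HasDerivAt X (X' t) t := fun t ht => by
    rw [hasDerivAt_pi]
    intro k
    have h1 := hd k k.2 (1 - t) (by linarith)
    have h2 : HasDerivAt (fun t : ℝ => 1 - t) (-1) t := by
      simpa using (hasDerivAt_id t).const_sub 1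
    have := h1.scomp t h2
    simpa [hX, hX', Function.comp_def] using this
  have hbound : ∀ t, 0 ≤ t → t < 1 → ‖X' t‖ ≤ K * ‖X t‖ := fun t ht0 ht => by
    rw [pi_norm_le_iff_of_nonneg (by positivity)]
    intro k
    simp only [hX', norm_neg]
    have hX0 : 0 ≤ ‖X t‖ := norm_nonneg _
    by_cases hk : (k : ℕ) + 1 < m
    · have h1 : ‖w (k + 1) (1 - t)‖ ≤ ‖X t‖ := norm_le_pi_norm (X t) ⟨k + 1, hk⟩
      calc _ ≤ 1 * ‖X t‖ := by rwa [one_mul]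
        _ ≤ _ := by gcongr; simp [hK]
    · have hkm : (k : ℕ) + 1 = m := by have := k.2; omega
      have h1 : ‖w 0 (1 - t)‖ ≤ ‖X t‖ := norm_le_pi_norm (X t) ⟨0, hm⟩
      have h2 : (1 - t) ^ s ≤ 1 := Real.rpow_le_one (by linarith) (by linarith) hs
      have h3 : 0 ≤ (1 - t) ^ s := Real.rpow_nonneg (by linarith) _
      rw [hkm, he _ (by linarith), norm_mul, norm_mul, Complex.norm_real, Real.norm_of_nonneg h3]
      calc _ ≤ ‖lam‖ * 1 * ‖X t‖ := by gcongr
        _ ≤ _ := by gcongr; simp [hK]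
  set B := ‖X 0‖ * Real.exp K with hB
  have hgron : ∀ t, 0 ≤ t → t < 1 → ‖X t‖ ≤ B := fun t ht0 ht => by
    have := norm_le_gronwallBound_of_norm_deriv_right_le (f := X) (f' := X') (δ := ‖X 0‖) (K := K)
      (ε := 0) (a := 0) (b := t)
      (fun x hx => (hder x (by linarith [hx.2])).continuousAt.continuousWithinAt)
      (fun x hx => (hder x (by linarith [hx.2])).hasDerivWithinAt) le_rfl
      (fun x hx => by rw [add_zero]; exact hbound x hx.1 (by linarith [hx.2])) t ⟨ht0, le_rfl⟩
    rw [gronwallBound_ε0, sub_zero] at this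
    refine this.trans ?_
    have hK0 : 0 ≤ K := by positivity
    rw [hB]
    gcongr
    nlinarith
  have hcont : ContinuousOn (w 0) (Ioi 0) := fun y hy =>
    (hd 0 hm y hy).continuousAt.continuousWithinAt
  have h01 : IntervalIntegrable (w 0) volume 0 1 := by
    rw [intervalIntegrable_iff_integrableOn_Ioc_of_le zero_le_one]
    refine Integrable.of_bound (C := B) ?_ ?_
    · exact (hcont.mono fun t ht => ht.1).aestronglyMeasurable measurableSet_Ioc
    · rw [ae_restrict_iff' measurableSet_Ioc]
      refine Eventually.of_forall fun y hy => ?_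
      have h1 := hgron (1 - y) (by linarith [hy.2]) (by linarith [hy.1])
      have h2 : ‖w 0 (1 - (1 - y))‖ ≤ ‖X (1 - y)‖ := norm_le_pi_norm (X (1 - y)) ⟨0, hm⟩
      rw [sub_sub_cancel] at h2
      exact h2.trans h1
  intro Y hY
  refine h01.trans (ContinuousOn.intervalIntegrable (hcont.mono fun t ht => ?_))
  exact (lt_min one_pos hY).trans_le ht.1

section chain

variable {γ : ℕ → ℝ} {m : ℕ} {s : ℝ} {lam : ℂ} {w : ℕ → ℝ → ℂ}

lemma IsSolutionChain.locInt_of_le (hγ : ∀ k ≤ m, 0 < γ k ∧ γ k ≤ 1)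
    (hw : IsSolutionChain γ m s lam w) {i j : ℕ} (hij : i ≤ j) (hj : j ≤ m) (h : LocInt (w j)) :
    LocInt (w i) := by
  induction j, hij using Nat.le_induction with
  | base => exact h
  | succ j hij ih =>
    have hg := hγ j (by omega)
    exact ih (by omega) ((hw.hasRLDeriv j (by omega)).exists_ae_eq hg.1 hg.2 h).1

/-- If some `γ_j < 1`, existence of the corresponding fractional integral gives integrability near
`0`; otherwise the equation is an ordinary differential equation. -/
lemma IsSolutionChain.locInt_zero (hm : 0 < m) (hγ : ∀ k ≤ m, 0 < γ k ∧ γ k ≤ 1) (hs : 0 ≤ s)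
    (hw : IsSolutionChain γ m s lam w) : LocInt (w 0) := by
  by_cases hall : ∀ k ≤ m, γ k = 1
  · exact hw.locInt_of_forall_eq_one hm hall hs
  push Not at hall
  obtain ⟨j, hj, hne⟩ := hall
  have hne' : 1 - γ j ≠ 0 := fun h => hne (by linarith)
  refine hw.locInt_of_le hγ (Nat.zero_le j) hj (LocInt.of_rlIntegralExists hne' ?_)
  rcases hj.lt_or_eq with hlt | rfl
  · exact (hw.hasRLDeriv j hlt).1
  · exact hw.integralExists

lemma IsSolutionChain.locInt (hm : 0 < m) (hγ : ∀ k ≤ m, 0 < γ k ∧ γ k ≤ 1) (hs : 0 ≤ s)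
    (hw : IsSolutionChain γ m s lam w) {j : ℕ} (hj : j ≤ m) : LocInt (w j) := by
  refine hw.locInt_of_le hγ hj le_rfl ?_
  by_cases h1 : 1 - γ m = 0
  · refine ((hw.locInt_zero hm hγ hs).rpow_mul hs lam).congr_ae ?_
    filter_upwards [ae_restrict_mem measurableSet_Ioi] with y hy
    rw [← hw.integral_eq y hy, rlIntegral, if_pos h1]
  · exact LocInt.of_rlIntegralExists h1 hw.integralExists

/-! ### The equivalent Volterra equation -/

/-- Undoing the first `j` derivatives. -/
lemma IsSolutionChain.exists_ae_eq (hm : 0 < m) (hγ : ∀ k ≤ m, 0 < γ k ∧ γ k ≤ 1) (hs : 0 ≤ s)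
    (hw : IsSolutionChain γ m s lam w) {j : ℕ} (hj : j ≤ m) : ∃ d : ℕ → ℂ,
      w 0 =ᵐ[volume.restrict (Ioi 0)] fun y =>
        ∑ k ∈ Finset.range j, d k * ((y ^ dnExp γ k : ℝ) : ℂ) +
          rlIntegral (∑ i ∈ Finset.range j, γ i) (w j) y := by
  induction j with
  | zero =>
    refine ⟨0, Eventually.of_forall fun y => ?_⟩
    simp [rlIntegral]
  | succ j ih =>
    obtain ⟨d, hd⟩ := ih (by omega)
    have hg := hγ j (by omega)
    have hloc := hw.locInt hm hγ hs hj
    obtain ⟨-, b, hb⟩ := (hw.hasRLDeriv j (by omega)).exists_ae_eq hg.1 hg.2 hloc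
    set σ := ∑ i ∈ Finset.range j, γ i with hσ
    have hσ0 : 0 ≤ σ := Finset.sum_nonneg fun i hi =>
      (hγ i (by have := Finset.mem_range.1 hi; omega)).1.le
    have e1 := rlIntegral_congr_ae (β := σ) hb
    have e2 := ((locInt_rpow (show -1 < γ j - 1 by linarith [hg.1])).const_mul b).rlIntegral_add
      (hloc.rlIntegral hg.1.le) hσ0
    have e3 := hloc.rlIntegral_rlIntegral hσ0 hg.1.le
    refine ⟨Function.update d j (b * ((Real.Gamma (γ j) / Real.Gamma (γ j + σ) : ℝ) : ℂ)), ?_⟩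
    filter_upwards [hd, e1, e2, e3, ae_restrict_mem measurableSet_Ioi] with y k0 k1 k2 k3 hy
    have hupd : ∀ v : ℂ, ∑ k ∈ Finset.range j, Function.update d j v k *
        ((y ^ dnExp γ k : ℝ) : ℂ) = ∑ k ∈ Finset.range j, d k * ((y ^ dnExp γ k : ℝ) : ℂ) :=
      fun v => Finset.sum_congr rfl fun k hk => by
        rw [Function.update_of_ne (ne_of_lt (Finset.mem_range.1 hk))]
    rw [k0, k1, k2, k3, rlIntegral_const_mul, rlIntegral_rpow hg.1 hσ0 hy, Finset.sum_range_succ,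
      Finset.sum_range_succ, Function.update_self, dnExp_eq, ← hσ, add_comm (γ j) σ, hupd]
    push_cast
    ring

/-- A solution satisfies `u = ∑ d_k y^{α_k} + I^α (λ y^s u)` almost everywhere. -/
lemma IsSolutionChain.exists_volterra (hm : 0 < m) (hγ : ∀ k ≤ m, 0 < γ k ∧ γ k ≤ 1)
    (hα : 0 < dnExp γ m) (hs : 0 ≤ s) (hw : IsSolutionChain γ m s lam w) : ∃ d : ℕ → ℂ,
      w 0 =ᵐ[volume.restrict (Ioi 0)] fun y =>
        ∑ k ∈ Finset.range m, d k * ((y ^ dnExp γ k : ℝ) : ℂ) +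
          rlIntegral (dnExp γ m) (fun t => lam * ((t ^ s : ℝ) : ℂ) * w 0 t) y := by
  obtain ⟨d, hd⟩ := hw.exists_ae_eq hm hγ hs le_rfl
  refine ⟨d, ?_⟩
  have e1 := (hw.locInt hm hγ hs le_rfl).rlIntegral_rlIntegral hα.le
    (sub_nonneg.2 (hγ m le_rfl).2)
  have e2 : ∑ i ∈ Finset.range m, γ i = 1 - γ m + dnExp γ m := by rw [dnExp_eq]; ring
  filter_upwards [hd, e1, ae_restrict_mem measurableSet_Ioi] with y k0 k1 hy
  rw [k0, e2, ← k1]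
  congr 1
  exact rlIntegral_congr (fun t ht => hw.integral_eq t ht) hy

end chain

open ContinuousLinearMap (mul) in
/-- Uniqueness for the homogeneous Volterra equation: in the weighted space `L¹(e^{-σy} dy)` on
`(0, N)` the operator `I^α (λ y^s ·)` has norm at most `|λ| N^s σ^{-α}`, which is less than one for
large `σ`. -/
lemma LocInt.ae_eq_zero_of_volterra {α : ℝ} (hα : 0 < α) {s : ℝ} (hs : 0 ≤ s) {lam : ℂ}
    {v : ℝ → ℂ} (hv : LocInt v) (h : v =ᵐ[volume.restrict (Ioi 0)]
      DN.rlIntegral α fun t => lam * ((t ^ s : ℝ) : ℂ) * v t) :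
    v =ᵐ[volume.restrict (Ioi 0)] 0 := by
  suffices H : ∀ n : ℕ, ∀ᵐ y, y ∈ Ioo (0 : ℝ) (n + 1) → v y = 0 by
    change ∀ᵐ y ∂_, _
    rw [ae_restrict_iff' measurableSet_Ioi]
    filter_upwards [ae_all_iff.2 H] with y hy hy0
    obtain ⟨n, hn⟩ := exists_nat_gt y
    exact hy n ⟨hy0, by linarith⟩
  intro n
  set N : ℝ := n + 1 with hN
  have hN0 : 0 < N := by positivity
  set C := ‖lam‖ * N ^ s with hC
  have hC0 : 0 ≤ C := by positivity
  obtain ⟨σ, hσ0, hσ⟩ : ∃ σ : ℝ, 0 < σ ∧ C * (1 / σ) ^ α < 1 := by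
    have h1 : Tendsto (fun σ : ℝ => C * σ ^ (-α)) atTop (𝓝 0) := by
      simpa using (tendsto_rpow_neg_atTop hα).const_mul C
    obtain ⟨σ, h2, h3⟩ := ((h1.eventually_lt_const one_pos).and (eventually_gt_atTop 0)).exists
    refine ⟨σ, h3, ?_⟩
    rwa [one_div, Real.inv_rpow h3.le, ← Real.rpow_neg h3.le]
  set F : ℝ → ℝ := indicator (Ioo 0 N) fun t => Real.exp (-(σ * t)) * ‖v t‖ with hF
  set G : ℝ → ℝ := fun t => rlKernel α t * Real.exp (-(σ * t)) with hG
  have hF0 : ∀ t, 0 ≤ F t := indicator_nonneg fun t _ => by positivity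
  have hG0 : ∀ t, 0 ≤ G t := fun t => mul_nonneg (rlKernel_nonneg hα t) (Real.exp_pos _).le
  have hFint : Integrable F := by
    rw [hF, integrable_indicator_iff measurableSet_Ioo]
    refine (hv.integrableOn hN0).norm.bdd_mul (c := 1) ?_ ?_
    · exact (by fun_prop : Continuous fun t : ℝ => Real.exp (-(σ * t))).aestronglyMeasurable
    · rw [ae_restrict_iff' measurableSet_Ioo]
      refine Eventually.of_forall fun t ht => ?_
      rw [Real.norm_of_nonneg (Real.exp_pos _).le, Real.exp_le_one_iff]
      have := mul_pos hσ0 ht.1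
      linarith
  have hGval : ∫ t, G t = (1 / σ) ^ α := by
    have e : G = indicator (Ioi 0) fun t =>
        (Real.Gamma α)⁻¹ * (t ^ (α - 1) * Real.exp (-(σ * t))) := by
      funext t
      by_cases ht : t ∈ Ioi (0 : ℝ)
      · simp only [hG, rlKernel, indicator_of_mem ht]
        ring
      · simp [hG, rlKernel, indicator_of_notMem ht]
    rw [e, integral_indicator measurableSet_Ioi, integral_const_mul,
      Real.integral_rpow_mul_exp_neg_mul_Ioi hα hσ0]
    have := (Real.Gamma_pos_of_pos hα).ne'
    field_simp
  have hGint : Integrable G := by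
    refine Integrable.of_integral_ne_zero ?_
    rw [hGval]
    positivity
  have hle : ∀ᵐ y, F y ≤ C * convolution F G (mul ℝ ℝ) volume y := by
    have h' := (ae_restrict_iff' measurableSet_Ioi).1 h
    filter_upwards [h', hFint.ae_convolution_exists (mul ℝ ℝ) hGint] with y hy hex
    by_cases hyN : y ∈ Ioo 0 N
    · rw [hF, indicator_of_mem hyN, ← hF, hy hyN.1, rlIntegral_eq_convolution hα.ne' _ hyN.1,
        convolution_def, convolution_def]
      simp only [ContinuousLinearMap.mul_apply'] at hex ⊢
      have key := norm_integral_le_of_norm_le (hex.const_mul (Real.exp (σ * y) * C))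
        (f := fun t => indicator (Ioi 0) (fun t => lam * ((t ^ s : ℝ) : ℂ) * v t) t *
          rlKernelC α (y - t)) (Eventually.of_forall fun t => ?_)
      · rw [integral_const_mul] at key
        calc _ ≤ Real.exp (-(σ * y)) * (Real.exp (σ * y) * C * ∫ t, F t * G (y - t)) := by
              gcongr
              exact key
          _ = (Real.exp (-(σ * y)) * Real.exp (σ * y)) * (C * ∫ t, F t * G (y - t)) := by ring
          _ = _ := by rw [← Real.exp_add, neg_add_cancel, Real.exp_zero, one_mul]
      · simp only [ContinuousLinearMap.mul_apply', norm_mul, norm_rlKernelC hα]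
        by_cases ht : 0 < t ∧ t < y
        · have htN : t ∈ Ioo 0 N := ⟨ht.1, ht.2.trans hyN.2⟩
          have hk := rlKernel_nonneg hα (y - t)
          simp only [hF, hG, indicator_of_mem htN, indicator_of_mem (mem_Ioi.2 ht.1), norm_mul,
            Complex.norm_real]
          have hts : ‖t ^ s‖ ≤ N ^ s := by
            rw [Real.norm_of_nonneg (Real.rpow_nonneg ht.1.le _)]
            exact Real.rpow_le_rpow ht.1.le htN.2.le hs
          have hexp : Real.exp (σ * y) * (Real.exp (-(σ * t)) * Real.exp (-(σ * (y - t)))) = 1 := by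
            rw [← Real.exp_add, ← Real.exp_add, Real.exp_eq_one_iff]
            ring
          calc ‖lam‖ * ‖t ^ s‖ * ‖v t‖ * rlKernel α (y - t)
              ≤ ‖lam‖ * N ^ s * ‖v t‖ * rlKernel α (y - t) := by gcongr
            _ = (Real.exp (σ * y) * (Real.exp (-(σ * t)) * Real.exp (-(σ * (y - t))))) *
                (C * ‖v t‖ * rlKernel α (y - t)) := by rw [hexp, one_mul]
            _ = _ := by ring
        · have : ‖indicator (Ioi 0) (fun t => lam * ((t ^ s : ℝ) : ℂ) * v t) t‖ *
              rlKernel α (y - t) = 0 := by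
            rw [not_and_or] at ht
            rcases ht with ht | ht
            · rw [indicator_of_notMem (by simpa using ht)]
              simp
            · have hk0 : rlKernel α (y - t) = 0 := indicator_of_notMem (by simpa using ht) _
              rw [hk0, mul_zero]
          rw [this]
          have := hF0 t
          have := hG0 (y - t)
          positivity
    · rw [hF, indicator_of_notMem hyN, ← hF, convolution_def]
      refine mul_nonneg hC0 (integral_nonneg fun t => ?_)
      exact mul_nonneg (hF0 t) (hG0 _)
  have hint := integral_mono_ae hFint
    ((hFint.integrable_convolution (mul ℝ ℝ) hGint).const_mul C) hle
  rw [integral_const_mul, integral_convolution (mul ℝ ℝ) hFint hGint, hGval] at hint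
  simp only [ContinuousLinearMap.mul_apply'] at hint
  have hI : ∫ t, F t = 0 := by
    have h0 : 0 ≤ ∫ t, F t := integral_nonneg hF0
    nlinarith
  have hFz := (integral_eq_zero_iff_of_nonneg hF0 hFint).1 hI
  filter_upwards [hFz] with y hy hyN
  simp only [hF, indicator_of_mem hyN, Pi.zero_apply] at hy
  simpa [(Real.exp_pos _).ne'] using hy

/-! ### The functions `u_k`: Volterra equation and linear independence -/

lemma locInt_genSeries {a : ℕ → ℂ} (ha : IsEntireSeq a) {b c : ℝ} (hc : 0 < c) (hb : -1 < b) :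
    LocInt (genSeries a b c) :=
  LocInt.of_rlIntegralExists one_ne_zero fun _ hy =>
    (rlIntegral_genSeries ha hc (fun n _ => by
      have : 0 ≤ n * c := by positivity
      linarith) zero_le_one hy).1

section fundSol

variable {γ : ℕ → ℝ} {m : ℕ} {s : ℝ} {lam : ℂ}

lemma eqOn_fundSol (hα : 0 < dnExp γ m) (k : ℕ) : EqOn (fundSol γ m s lam k)
    (genSeries (fundCoeff (dnExp γ m) s (dnExp γ k) lam) (dnExp γ k) (dnExp γ m + s)) (Ioi 0) :=
  fun _ hy => fundSol_eq_genSeries hα s lam k hy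

lemma neg_one_lt_dnExp (hγ : ∀ k ≤ m, 0 < γ k ∧ γ k ≤ 1) {k : ℕ} (hk : k ≤ m) :
    -1 < dnExp γ k := by
  have : 0 < ∑ j ∈ Finset.range (k + 1), γ j := Finset.sum_pos
    (fun j hj => (hγ j (by have := Finset.mem_range.1 hj; omega)).1) ⟨0, by simp⟩
  unfold dnExp
  linarith

lemma dnExp_lt_dnExp (hγ : ∀ k ≤ m, 0 < γ k ∧ γ k ≤ 1) {i j : ℕ} (hij : i < j) (hj : j ≤ m) :
    dnExp γ i < dnExp γ j := by
  induction j, hij using Nat.le_induction with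
  | base =>
    have := (hγ (i + 1) hj).1
    simp only [dnExp, Finset.sum_range_succ _ (i + 1)]
    linarith
  | succ j _ ih =>
    have := (hγ (j + 1) hj).1
    have h := ih (by omega)
    simp only [dnExp, Finset.sum_range_succ _ (j + 1)] at h ⊢
    linarith

lemma locInt_fundSol (hγ : ∀ k ≤ m, 0 < γ k ∧ γ k ≤ 1) (hα : 0 < dnExp γ m) (hs : 0 ≤ s) {k : ℕ}
    (hk : k ≤ m) : LocInt (fundSol γ m s lam k) := by
  have hb := neg_one_lt_dnExp hγ hk
  refine (locInt_genSeries (isEntireSeq_fundCoeff hα hs hb lam) (c := dnExp γ m + s)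
    (by linarith) hb).congr_ae ?_
  filter_upwards [ae_restrict_mem measurableSet_Ioi] with y hy
  exact (eqOn_fundSol hα k hy).symm

/-- `u_k = y^{α_k} + I^α (λ y^s u_k)`, with no condition on the exponents. -/
lemma fundSol_volterra (hγ : ∀ k ≤ m, 0 < γ k ∧ γ k ≤ 1) (hα : 0 < dnExp γ m) (hs : 0 ≤ s) {k : ℕ}
    (hk : k ≤ m) {y : ℝ} (hy : 0 < y) : fundSol γ m s lam k y = ((y ^ dnExp γ k : ℝ) : ℂ) +
      rlIntegral (dnExp γ m) (fun t => lam * ((t ^ s : ℝ) : ℂ) * fundSol γ m s lam k t) y := by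
  have hb := neg_one_lt_dnExp hγ hk
  set α := dnExp γ m with hαdef
  set b := dnExp γ k with hbdef
  have hc : 0 < α + s := by linarith
  have hE := isEntireSeq_fundCoeff hα hs hb lam
  have h1 : EqOn (fun t => lam * ((t ^ s : ℝ) : ℂ) * fundSol γ m s lam k t)
      (fun t => lam * genSeries (fundCoeff α s b lam) (b + s) (α + s) t) (Ioi 0) := fun t ht => by
    simp only
    rw [eqOn_fundSol hα k ht, mul_assoc, rpow_mul_genSeries _ _ _ _ ht]
  rw [rlIntegral_congr h1 hy, rlIntegral_const_mul, (rlIntegral_genSeries hE hc (fun n _ => by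
      have : 0 ≤ n * (α + s) := by positivity
      linarith) hα.le hy).2, eqOn_fundSol hα k hy, genSeries_eq_add_shift hE _ _ hy,
    fundCoeff_zero, one_mul]
  congr 1
  rw [genSeries, genSeries, ← tsum_mul_left]
  refine tsum_congr fun n => ?_
  rw [fundCoeff_succ, ← mul_assoc, show b + s + n * (α + s) + 1 = (α + s) * n + s + b + 1 by ring,
    show b + s + α + n * (α + s) = b + (α + s) + n * (α + s) by ring]
  simp only [← hαdef, ← hbdef]
  ring

end fundSol

lemma tendsto_genSeries_zero {a : ℕ → ℂ} (ha : IsEntireSeq a) {c : ℝ} (hc : 0 < c) :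
    Tendsto (genSeries a 0 c) (𝓝[>] 0) (𝓝 (a 0)) := by
  have hsum : Summable fun n => ‖a n‖ := by simpa using ha 1 one_pos
  have := tendsto_tsum_of_dominated_convergence (𝓕 := 𝓝[>] (0 : ℝ))
    (f := fun y n => a n * ((y ^ (0 + n * c) : ℝ) : ℂ)) (g := fun n => if n = 0 then a 0 else 0)
    hsum (fun n => ?_) ?_
  · rwa [tsum_ite_eq] at this
  · rcases eq_or_ne n 0 with rfl | hn
    · simp
    · have hnc : 0 < 0 + n * c := by
        have : (0 : ℝ) < n := by exact_mod_cast Nat.pos_of_ne_zero hn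
        positivity
      have h1 : Tendsto (fun y : ℝ => y ^ (0 + n * c)) (𝓝[>] 0) (𝓝 0) := by
        have := (Real.continuousAt_rpow_const 0 (0 + n * c) (Or.inr hnc.le)).tendsto
        rw [Real.zero_rpow hnc.ne'] at this
        exact this.mono_left nhdsWithin_le_nhds
      have h2 := (Complex.continuous_ofReal.tendsto 0).comp h1
      simpa [hn] using h2.const_mul (a n)
  · filter_upwards [Ioo_mem_nhdsGT (zero_lt_one' ℝ)] with y hy n
    rw [norm_mul, Complex.norm_real, Real.norm_of_nonneg (Real.rpow_nonneg hy.1.le _)]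
    have : y ^ (0 + n * c) ≤ 1 := Real.rpow_le_one hy.1.le hy.2.le (by positivity)
    exact mul_le_of_le_one_right (norm_nonneg _) this

/-- Since `u_k(y) ∼ y^{α_k}` as `y → 0` with increasing exponents, the coefficients of a vanishing
linear combination vanish one after the other. -/
lemma linearIndependent_fundSol {γ : ℕ → ℝ} {m : ℕ} (hγ : ∀ k ≤ m, 0 < γ k ∧ γ k ≤ 1)
    (hα : 0 < dnExp γ m) {s : ℝ} (hs : 0 ≤ s) (lam : ℂ) :
    LinearIndependent ℂ (fun (k : Fin m) (y : Set.Ioi (0 : ℝ)) => fundSol γ m s lam k y) := by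
  rw [Fintype.linearIndependent_iff]
  intro g hg i
  induction i using WellFoundedLT.induction with
  | ind i ih =>
  have hc : 0 < dnExp γ m + s := by linarith
  have hE := fun k : Fin m => isEntireSeq_fundCoeff hα hs (neg_one_lt_dnExp hγ k.2.le) lam
  have hlim : Tendsto (fun y : ℝ => ∑ k : Fin m, g k * (((y ^ (dnExp γ k - dnExp γ i) : ℝ) : ℂ) *
      genSeries (fundCoeff (dnExp γ m) s (dnExp γ k) lam) 0 (dnExp γ m + s) y)) (𝓝[>] 0)
      (𝓝 (∑ k : Fin m, if k = i then g i else 0)) := by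
    refine tendsto_finsetSum _ fun k _ => ?_
    have hk := tendsto_genSeries_zero (hE k) hc
    rw [fundCoeff_zero] at hk
    rcases lt_trichotomy k i with hki | rfl | hki
    · simp [ih k hki, hki.ne]
    · simpa using hk.const_mul (g k)
    · have hpos : 0 < dnExp γ k - dnExp γ i := sub_pos.2 (dnExp_lt_dnExp hγ hki k.2.le)
      have h1 : Tendsto (fun y : ℝ => y ^ (dnExp γ k - dnExp γ i)) (𝓝[>] 0) (𝓝 0) := by
        have := (Real.continuousAt_rpow_const 0 _ (Or.inr hpos.le)).tendsto
        rw [Real.zero_rpow hpos.ne'] at this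
        exact this.mono_left nhdsWithin_le_nhds
      have h2 := (Complex.continuous_ofReal.tendsto 0).comp h1
      simpa [hki.ne'] using (h2.mul hk).const_mul (g k)
  have hzero : (fun y : ℝ => ∑ k : Fin m, g k * (((y ^ (dnExp γ k - dnExp γ i) : ℝ) : ℂ) *
      genSeries (fundCoeff (dnExp γ m) s (dnExp γ k) lam) 0 (dnExp γ m + s) y))
      =ᶠ[𝓝[>] 0] fun _ => 0 := by
    filter_upwards [self_mem_nhdsWithin] with y hy
    have h1 := congrFun hg ⟨y, hy⟩
    simp only [Finset.sum_apply, Pi.smul_apply, smul_eq_mul, Pi.zero_apply] at h1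
    calc _ = ((y ^ (-dnExp γ i) : ℝ) : ℂ) * ∑ k : Fin m, g k * fundSol γ m s lam k y := by
          rw [Finset.mul_sum]
          refine Finset.sum_congr rfl fun k _ => ?_
          rw [eqOn_fundSol hα k hy, mul_left_comm ((y ^ (-dnExp γ i) : ℝ) : ℂ), rpow_mul_genSeries _ _ _ _ hy,
            rpow_mul_genSeries _ _ _ _ hy, zero_add, sub_eq_add_neg]
      _ = 0 := by rw [h1, mul_zero]
  have := tendsto_nhds_unique hlim (tendsto_const_nhds.congr' hzero.symm)
  simpa using this

/-- Every solution and the corresponding combination of the `u_k` solve the same inhomogeneous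
Volterra equation, whose solution is unique. -/
lemma IsSolution.exists_ae_eq {γ : ℕ → ℝ} {m : ℕ} (hm : 0 < m)
    (hγ : ∀ k ≤ m, 0 < γ k ∧ γ k ≤ 1) (hα : 0 < dnExp γ m) {s : ℝ} (hs : 0 ≤ s) {lam : ℂ}
    {u : ℝ → ℂ} (hu : IsSolution γ m s lam u) : ∃ d : Fin m → ℂ,
      ∀ᵐ y ∂(volume.restrict (Ioi (0 : ℝ))), u y = ∑ k : Fin m, d k * fundSol γ m s lam k y := by
  obtain ⟨w, hwu, hw⟩ := (isSolution_iff hγ s lam u).1 hu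
  obtain ⟨d, hd⟩ := hw.exists_volterra hm hγ hα hs
  have hwloc := hw.locInt_zero hm hγ hs
  set U : ℝ → ℂ := fun y => ∑ k ∈ Finset.range m, d k * fundSol γ m s lam k y with hU
  have hUloc : LocInt U := LocInt.sum fun k hk =>
    (locInt_fundSol hγ hα hs (Finset.mem_range.1 hk).le).const_mul (d k)
  have hv := hwloc.sub hUloc
  have hz : (fun y => w 0 y - U y) =ᵐ[volume.restrict (Ioi 0)] 0 := by
    refine hv.ae_eq_zero_of_volterra hα hs (lam := lam) ?_
    have hex : ∀ᵐ y ∂(volume.restrict (Ioi 0)), ∀ k : ℕ, k ∈ Finset.range m →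
        RLIntegralExists (dnExp γ m)
          (fun t => lam * ((t ^ s : ℝ) : ℂ) * fundSol γ m s lam k t) y := by
      rw [ae_all_iff]
      intro k
      by_cases hk : k ∈ Finset.range m
      · filter_upwards [((locInt_fundSol hγ hα hs (Finset.mem_range.1 hk).le).rpow_mul hs
          lam).ae_rlIntegralExists hα.le] with y hy _ using hy
      · exact Eventually.of_forall fun y h => absurd h hk
    have hadd := (hv.rpow_mul hs lam).rlIntegral_add (hUloc.rpow_mul hs lam) hα.le
    filter_upwards [hd, hex, hadd, ae_restrict_mem measurableSet_Ioi] with y h1 h2 h3 hy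
    have hUy : U y = ∑ k ∈ Finset.range m, d k * ((y ^ dnExp γ k : ℝ) : ℂ) +
        rlIntegral (dnExp γ m) (fun t => lam * ((t ^ s : ℝ) : ℂ) * U t) y := by
      have e : (fun t => lam * ((t ^ s : ℝ) : ℂ) * U t) = fun t => ∑ k ∈ Finset.range m,
          d k * (lam * ((t ^ s : ℝ) : ℂ) * fundSol γ m s lam k t) := by
        funext t
        rw [hU, Finset.mul_sum]
        exact Finset.sum_congr rfl fun k _ => by ring
      rw [e, rlIntegral_sum h2, ← Finset.sum_add_distrib]
      refine Finset.sum_congr rfl fun k hk => ?_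
      rw [fundSol_volterra hγ hα hs (Finset.mem_range.1 hk).le hy, mul_add]
    have e2 : (fun t => lam * ((t ^ s : ℝ) : ℂ) * (w 0 t - U t) +
        lam * ((t ^ s : ℝ) : ℂ) * U t) = fun t => lam * ((t ^ s : ℝ) : ℂ) * w 0 t := by
      funext t; ring
    rw [e2] at h3
    rw [h1, hUy, h3]
    ring
  refine ⟨fun k => d k, ?_⟩
  filter_upwards [hz, ae_restrict_mem measurableSet_Ioi] with y h1 hy
  rw [← hwu hy, sub_eq_zero.1 h1, hU]
  exact (Fin.sum_univ_eq_sum_range (fun k => d k * fundSol γ m s lam k y) m).symm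

lemma continuousOn_fundSol {γ : ℕ → ℝ} {m : ℕ} (hγ : ∀ k ≤ m, 0 < γ k ∧ γ k ≤ 1)
    (hα : 0 < dnExp γ m) {s : ℝ} (hs : 0 ≤ s) {lam : ℂ} {k : ℕ} (hk : k ≤ m) :
    ContinuousOn (fundSol γ m s lam k) (Ioi 0) :=
  (continuousOn_genSeries (isEntireSeq_fundCoeff hα hs (neg_one_lt_dnExp hγ hk) lam) _
    (by linarith)).congr (eqOn_fundSol hα k)

end DN

theorem mainTheorem1 (m : ℕ) (γ : ℕ → ℝ) (hγ : ∀ k ≤ m, 0 < γ k ∧ γ k ≤ 1)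
    (hα : 0 < DN.dnExp γ m) (s : ℝ) (hs : 0 ≤ s) (lam : ℂ) :
    -- absolute convergence of the Kilbas–Saigo series on the whole complex plane
    (∀ k < m, ∀ z : ℂ, Summable fun i : ℕ =>
      ‖(DN.kilbasSaigoCoeff (DN.dnExp γ m) ((DN.dnExp γ m + s) / DN.dnExp γ m)
        ((DN.dnExp γ k + s) / DN.dnExp γ m) i : ℂ) * z ^ i‖) ∧
    -- explicit series form of `u_k`
    (∀ k < m, ∀ y : ℝ, 0 < y → HasSum (fun n : ℕ =>
      ((y ^ DN.dnExp γ k : ℝ) : ℂ) *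
        (((∏ j ∈ Finset.range n,
            Real.Gamma ((DN.dnExp γ m + s) * j + s + DN.dnExp γ k + 1)) /
          (∏ j ∈ Finset.range n,
            Real.Gamma ((DN.dnExp γ m + s) * j + s + DN.dnExp γ k + 1 + DN.dnExp γ m)) : ℝ) *
          (lam * ((y ^ (DN.dnExp γ m + s) : ℝ) : ℂ)) ^ n))
      (DN.fundSol γ m s lam k y)) ∧
    -- linear independence on `(0, ∞)`
    LinearIndependent ℂ (fun (k : Fin m) (y : Set.Ioi (0 : ℝ)) => DN.fundSol γ m s lam k y) ∧
    -- the `u_k` are solutions, continuous on `(0, ∞)`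
    (∀ k < m, ContinuousOn (DN.fundSol γ m s lam k) (Set.Ioi 0)) ∧
    (∀ k < m, (lam = 0 ∨ 0 < DN.dnExp γ k + s + γ m) →
      DN.IsSolution γ m s lam (DN.fundSol γ m s lam k)) ∧
    -- every solution agrees almost everywhere with a linear combination of the `u_k`
    (∀ u : ℝ → ℂ, DN.IsSolution γ m s lam u → ∃ d : Fin m → ℂ,
      ∀ᵐ y ∂(MeasureTheory.volume.restrict (Set.Ioi (0 : ℝ))),
        u y = ∑ k : Fin m, d k * DN.fundSol γ m s lam k y) ∧
    -- the general (continuous) solution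
    ((lam = 0 ∨ 1 < γ 0 + γ m + s) → ∀ u : ℝ → ℂ, ContinuousOn u (Set.Ioi 0) →
      (DN.IsSolution γ m s lam u ↔ ∃ d : Fin m → ℂ,
        ∀ y : ℝ, 0 < y → u y = ∑ k : Fin m, d k * DN.fundSol γ m s lam k y)) := by
  have hm : 0 < m := by
    rcases Nat.eq_zero_or_pos m with rfl | h
    · have := (hγ 0 le_rfl).2
      simp only [DN.dnExp, zero_add, Finset.sum_range_one] at hα
      linarith
    · exact h
  have hsol : ∀ k < m, (lam = 0 ∨ 0 < DN.dnExp γ k + s + γ m) →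
      DN.IsSolution γ m s lam (DN.fundSol γ m s lam k) :=
    fun k hk h => DN.isSolution_fundSol hγ hα hs hk h
  refine ⟨fun k hk z => ?_, fun k hk y hy => ?_, DN.linearIndependent_fundSol hγ hα hs lam,
    fun k hk => DN.continuousOn_fundSol hγ hα hs hk.le, hsol,
    fun u hu => hu.exists_ae_eq hm hγ hα hs, fun hcond u hucont => ⟨fun hu => ?_, ?_⟩⟩
  · have h := DN.isEntireSeq_fundCoeff hα hs (DN.neg_one_lt_dnExp hγ hk.le) z 1 one_pos
    simpa only [one_pow, mul_one, DN.fundCoeff, DN.kilbasSaigoCoeff_eq hα] using h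
  · rw [DN.fundSol_eq_genSeries hα s lam k hy]
    have h := DN.hasSum_genSeries
      (DN.isEntireSeq_fundCoeff hα hs (DN.neg_one_lt_dnExp hγ hk.le) lam)
      (DN.dnExp γ k) (DN.dnExp γ m + s) hy
    refine h.congr_fun fun n => ?_
    rw [DN.fundCoeff, DN.rpow_add_nat_mul hy, Finset.prod_div_distrib, mul_pow]
    push_cast
    ring
  · obtain ⟨d, hd⟩ := hu.exists_ae_eq hm hγ hα hs
    refine ⟨d, fun y hy => ?_⟩
    refine Measure.eqOn_open_of_ae_eq (f := u)
      (g := fun y => ∑ k : Fin m, d k * DN.fundSol γ m s lam k y) hd isOpen_Ioi hucont ?_ hy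
    exact continuousOn_finsetSum _ fun k _ =>
      continuousOn_const.mul (DN.continuousOn_fundSol hγ hα hs k.2.le)
  · rintro ⟨d, hd⟩
    refine DN.IsSolution.sum hγ (S := Finset.univ)
      (fun (k : Fin m) _ => hsol k k.2 (hcond.imp_right fun h => ?_)) d hd
    have h0 : DN.dnExp γ 0 ≤ DN.dnExp γ k := by
      rcases Nat.eq_zero_or_pos (k : ℕ) with h | h
      · rw [h]
      · exact (DN.dnExp_lt_dnExp hγ h k.2.le).le
    simp only [DN.dnExp, zero_add, Finset.sum_range_one] at h0 ⊢
    linarith
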